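/- Let $(W,H,\mu)$ be an abstract Wiener space: $W$ is a separable locally convex Fréchet space, $\mu$ is a centred Gaussian measure with support $W$, and $H\subset W$ is its Cameron–Martin space. Let $\nabla$ be the derivative in the directions of $H$, let $\delta^n$ be the adjoint of $\nabla^n$ with respect to $\mu$, and let $\mathcal L=\delta\circ\nabla$. Let $\mathbb D=\bigcap_{p>1,\,s\in\mathbb R}\mathbb D_{p,s}$ be the space of test functions, where $\mathbb D_{p,s}$ has the norm $\|(I+\mathcal L)^{s/2}\varphi\|_{L^p(\mu)}$, and let $\mathbb D'$ be its continuous dual. Let $m\in\mathbb D'$ be a positive distribution, i.e. $\langle m,\varphi\rangle\ge 0$ for every $\varphi\in\mathbb D$ with $\varphi\ge0$ $\mu$-a.s., and assume that its total mass $m(W)=\langle m,1\rangle$ is not zero. Then there are $M_1\in H$ and a Hilbert–Schmidt operator $M_2$ on $H$ (an element of $H\otimes H$) with $$(M_1,h)_H=\langle m,\delta h\rangle,\qquad (M_2h,k)_H=\langle m,\delta^2(h\otimes k)\rangle\qquad(h,k\in H),$$ and, as an inequality between bounded self-adjoint operators on $H$, $$I_H+\frac{1}{m(W)}M_2\ \ge\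 \frac{1}{m(W)^2}\,M_1\otimes M_1 .$$ In particular, the projection $m_2$ of $m$ to the second Wiener chaos (the element of the second chaos, contained in $L^2(\mu)$, determined by $E[m_2\varphi]=\langle m,J_2\varphi\rangle$ for $\varphi\in\mathbb D$, with $J_2$ the orthogonal projection of $L^2(\mu)$ to the second chaos) exists, and $m_2/m(W)$ is $1$-convex: the map $h\mapsto \frac12|h|_H^2+\frac{1}{m(W)}m_2(\cdot+h)$ is convex on $H$ with values in $L^0(\mu)$. -/

import Mathlib

open MeasureTheory ProbabilityTheory
open scoped ENNReal NNReal InnerProductSpace ContDiff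

namespace WienerSpace

section AbstractWienerSpace

variable {W H : Type*} [AddCommGroup W] [Module ℝ W] [TopologicalSpace W] [MeasurableSpace W]
  [NormedAddCommGroup H] [InnerProductSpace ℝ H]

/-- `(W, H, μ)` is an abstract Wiener space, the Cameron-Martin space `H` being realised in `W`
through the injection `i`: every continuous linear functional `ℓ` on `W` is a centred Gaussian
variable of variance `|i* ℓ|²_H`, and the support of `μ` is `W`.  (`W` is meant to be a separable
locally convex Fréchet space and `H` to be complete.) -/
structure IsAbstractWienerSpace (i : H →L[ℝ] W) (μ : Measure W) : Prop where
  injective : Function.Injective i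
  map_dual : ∀ ℓ : W →L[ℝ] ℝ, μ.map ℓ = gaussianReal 0 (‖ℓ.comp i‖₊ ^ 2)
  isOpenPosMeasure : μ.IsOpenPosMeasure

/-- Smooth cylindrical functions `φ = g(ℓ₁, …, ℓₙ)` with `ℓⱼ ∈ W*` and `g ∈ C_b^∞(ℝⁿ)`. -/
def IsSmoothCylindrical (φ : W → ℝ) : Prop :=
  ∃ (n : ℕ) (ℓ : Fin n → W →L[ℝ] ℝ) (g : (Fin n → ℝ) → ℝ),
    ContDiff ℝ ∞ g ∧
    (∀ k : ℕ, ∃ C : ℝ, ∀ x, ‖iteratedFDeriv ℝ k g x‖ ≤ C) ∧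
    ∀ w, φ w = g (fun j => ℓ j w)

/-- The `n`-th gradient `∇ⁿφ(w)`, as an `n`-linear form on `H`: the `n`-th derivative of `φ` at `w`
in the directions of `H`. -/
noncomputable def grad (i : H →L[ℝ] W) (n : ℕ) (φ : W → ℝ) (w : W) : H [×n]→L[ℝ] ℝ :=
  iteratedFDeriv ℝ n (fun x : H => φ (w + i x)) 0

/-- `Z = δⁿ(h₁ ⊗ ⋯ ⊗ hₙ)`, where `δⁿ` is the adjoint of `∇ⁿ` with respect to `μ`:
`E[Z φ] = E[(∇ⁿφ, h₁ ⊗ ⋯ ⊗ hₙ)]` for all smooth cylindrical `φ`. -/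
def IsDivergence (i : H →L[ℝ] W) (μ : Measure W) {n : ℕ} (h : Fin n → H) (Z : Lp ℝ 2 μ) : Prop :=
  ∀ φ : W → ℝ, IsSmoothCylindrical φ →
    ∫ w, Z w * φ w ∂μ = ∫ w, grad i n φ w h ∂μ

/-- `f` is `r`-convex: `h ↦ (r/2) |h|²_H + f(w + h)` is convex on `H` with values in `L⁰(μ)`. -/
def IsRConvex (i : H →L[ℝ] W) (μ : Measure W) (r : ℝ) (f : W → ℝ) : Prop :=
  ∀ (h k : H) (s t : ℝ), 0 ≤ s → 0 ≤ t → s + t = 1 →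
    ∀ᵐ w ∂μ, r / 2 * ‖s • h + t • k‖ ^ 2 + f (w + i (s • h + t • k))
      ≤ s * (r / 2 * ‖h‖ ^ 2 + f (w + i h)) + t * (r / 2 * ‖k‖ ^ 2 + f (w + i k))

/-- Hilbert-Schmidt operators on `H`, that is, the elements of the Hilbert space tensor product
`H ⊗ H`. -/
def IsHilbertSchmidt (T : H →L[ℝ] H) : Prop :=
  ∀ e : Set H, Orthonormal ℝ ((↑) : e → H) → Summable fun x : e => ‖T x‖ ^ 2

end AbstractWienerSpace

section Sobolev

variable {W : Type*} [AddCommGroup W] [Module ℝ W] [TopologicalSpace W] [MeasurableSpace W]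

/-- The closure in `L²(μ)` of the polynomials of degree at most `n` in the elements of `W*`. -/
noncomputable def polySpace (μ : Measure W) (n : ℕ) : Submodule ℝ (Lp ℝ 2 μ) :=
  (Submodule.span ℝ {F : Lp ℝ 2 μ | ∃ k ≤ n, ∃ ℓ : Fin k → W →L[ℝ] ℝ,
    F =ᵐ[μ] fun w => ∏ j, ℓ j w}).topologicalClosure

/-- The `n`-th (homogeneous) Wiener chaos. -/
noncomputable def chaos (μ : Measure W) : ℕ → Submodule ℝ (Lp ℝ 2 μ)
  | 0 => polySpace μ 0
  | n + 1 => polySpace μ (n + 1) ⊓ (polySpace μ n)ᗮ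

/-- `g = (I + 𝓛)^{s/2} f` in `L²(μ)`, where the Ornstein-Uhlenbeck operator `𝓛 = δ ∘ ∇` is
multiplication by `n` on the `n`-th chaos: the `n`-th chaos component of `g` is `(1 + n)^{s/2}`
times that of `f`, for every `n`. -/
def IsBesselPow (μ : Measure W) (s : ℝ) (f g : Lp ℝ 2 μ) : Prop :=
  ∀ n : ℕ, ∀ u ∈ chaos μ n, ⟪u, g⟫_ℝ = (1 + n : ℝ) ^ (s / 2) * ⟪u, f⟫_ℝ

/-- The space `𝔻 = ⋂_{p > 1, s ∈ ℝ} 𝔻_{p,s}` of test functions, where `f ∈ 𝔻_{p,s}` means that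
`‖f‖_{p,s} = ‖(I + 𝓛)^{s/2} f‖_{L^p(μ)}` is finite. (As `𝔻 ⊆ 𝔻_{2,s}` for all `s`, it is a space
of elements of `L²(μ)` on which all the `(I + 𝓛)^{s/2}` are defined in `L²(μ)`.) -/
noncomputable def testSpace (μ : Measure W) : Submodule ℝ (Lp ℝ 2 μ) where
  carrier := {f | ∀ p : ℝ≥0∞, 1 < p → p ≠ ⊤ → ∀ s : ℝ,
    ∃ g : Lp ℝ 2 μ, IsBesselPow μ s f g ∧ MemLp g p μ}
  add_mem' := by
    intro f₁ f₂ h₁ h₂ p hp hp' s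
    obtain ⟨g₁, hg₁, hm₁⟩ := h₁ p hp hp' s
    obtain ⟨g₂, hg₂, hm₂⟩ := h₂ p hp hp' s
    refine ⟨g₁ + g₂, fun n u hu => ?_, (memLp_congr_ae (Lp.coeFn_add g₁ g₂)).2 (hm₁.add hm₂)⟩
    rw [inner_add_right, inner_add_right, hg₁ n u hu, hg₂ n u hu]
    ring
  zero_mem' := by
    intro p _ _ s
    refine ⟨0, fun n u _ => by simp, (memLp_congr_ae (Lp.coeFn_zero ℝ 2 μ)).2 MemLp.zero⟩
  smul_mem' := by
    intro c f h p hp hp' s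
    obtain ⟨g, hg, hm⟩ := h p hp hp' s
    refine ⟨c • g, fun n u hu => ?_, (memLp_congr_ae (Lp.coeFn_smul c g)).2 (hm.const_smul c)⟩
    rw [real_inner_smul_right, real_inner_smul_right, hg n u hu]
    ring

/-- The linear form `m` on `𝔻` belongs to `𝔻' = ⋃_{p > 1, s ∈ ℝ} 𝔻_{p,s}`, the dual of `𝔻`: it is
continuous for one of the norms `‖f‖_{p,s} = ‖(I + 𝓛)^{s/2} f‖_{L^p(μ)}`. -/
def IsDistribution {μ : Measure W} (m : testSpace μ →ₗ[ℝ] ℝ) : Prop :=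
  ∃ (p : ℝ≥0∞) (s : ℝ) (C : ℝ≥0), 1 < p ∧ p ≠ ⊤ ∧
    ∀ (f : testSpace μ) (g : Lp ℝ 2 μ), IsBesselPow μ s f g →
      ENNReal.ofReal |m f| ≤ C * eLpNorm g p μ

/-- Positivity of a distribution. -/
def IsPositiveDistribution {μ : Measure W} (m : testSpace μ →ₗ[ℝ] ℝ) : Prop :=
  ∀ f : testSpace μ, (∀ᵐ w ∂μ, 0 ≤ (f : Lp ℝ 2 μ) w) → 0 ≤ m f

/-- `F` is the projection `J_n m` of the distribution `m` to the `n`-th Wiener chaos: `F` belongs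
to the `n`-th chaos and `⟨J_n m, φ⟩ = ⟨m, J_n φ⟩` for `φ ∈ 𝔻`. Here `ψ = J_n φ`. -/
def IsChaosProjection {μ : Measure W} (m : testSpace μ →ₗ[ℝ] ℝ) (n : ℕ) (F : Lp ℝ 2 μ) : Prop :=
  F ∈ chaos μ n ∧
  ∀ φ ψ : testSpace μ, (ψ : Lp ℝ 2 μ) ∈ chaos μ n → (φ - ψ : Lp ℝ 2 μ) ∈ (chaos μ n)ᗮ →
    ⟪F, (φ : Lp ℝ 2 μ)⟫_ℝ = m ψ

theorem const_one_mem_testSpace (μ : Measure W) [IsProbabilityMeasure μ] :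
    Lp.const 2 μ (1 : ℝ) ∈ testSpace μ := by
  have h0 : ∀ n, Lp.const 2 μ (1 : ℝ) ∈ polySpace μ n := fun n =>
    Submodule.le_topologicalClosure _ (Submodule.subset_span
      ⟨0, Nat.zero_le n, Fin.elim0, by
        simpa using (show Lp.const 2 μ (1 : ℝ) =ᵐ[μ] fun _ => (1 : ℝ) from
          Lp.coeFn_const (p := 2) (μ := μ) (1 : ℝ))⟩)
  intro p _ _ s
  refine ⟨Lp.const 2 μ (1 : ℝ), ?_,
    (memLp_congr_ae (Lp.coeFn_const (p := 2) (μ := μ) (1 : ℝ))).2 (memLp_const 1)⟩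
  rintro (_ | n) u hu
  · simp
  · have : ⟪u, Lp.const 2 μ (1 : ℝ)⟫_ℝ = 0 :=
      Submodule.inner_left_of_mem_orthogonal (h0 n) hu.2
    rw [this, mul_zero]

/-- The total mass `m(W) = ⟨m, 1⟩`. -/
noncomputable def mass {μ : Measure W} [IsProbabilityMeasure μ] (m : testSpace μ →ₗ[ℝ] ℝ) : ℝ :=
  m ⟨Lp.const 2 μ (1 : ℝ), const_one_mem_testSpace μ⟩

end Sobolev

end WienerSpace

open WienerSpace

/-!
The proof is a test of the positivity of `m` on squares. For `h ∈ H` let `δh` be the Gaussian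
variable attached to `h` by the Paley-Wiener isometry. Then
`(δh + c)² = δ²(h ⊗ h) + 2 c δh + (|h|² + c²)` is a nonnegative test function, so
`(M₂ h, h) + 2 c (M₁, h) + (|h|² + c²) m(W) ≥ 0` for every real `c`
(`IsPositiveDistribution.quadratic_nonneg`), and the choice `c = -(M₁, h) / m(W)` is the operator
inequality. What remains is to see that the objects exist and have the stated properties.

* *Divergences.* `W*` is mapped to a dense subspace of `H` by the adjoint of the injection, which
  defines `δh` as an `L²` limit of continuous functionals. The Cameron-Martin theorem is obtained by
  comparing the moment generating functions of all continuous functionals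
  (`map_add_eq_withDensity`), and integration by parts by differentiating it
  (`integral_mul_deriv_eq`). Hence `δh` and `δ²(h ⊗ k) = δh δk - (h, k)` are the divergences
  (`isDivergence_paleyWiener`, `isDivergence_divTwo`).

* *Continuity of `m` on a chaos.* `m` is bounded by some `‖(I + 𝓛)^{s/2} ·‖_p`, and on a chaos the
  Bessel potential is a scalar, so it suffices that `‖·‖_p ≤ K ‖·‖_2` on polynomials of degree at
  most two (`exists_eLpNorm_le_of_mem_polySpace`). Instead of hypercontractivity this uses a
  rotation: for independent copies `X`, `Y` and `U = (X - Y)/√2`, `V = (X + Y)/√2`, which are again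
  independent copies, `P(X) - P(Y)` is linear in `U` and affine in `V`. Its sections are affine
  functionals of a Gaussian variable, for which the estimate is trivial, and Minkowski's integral
  inequality combines the two variables (`eLpNorm_prod_le_of_sections`). So the chaoses of order at
  most two consist of test functions, and Riesz' theorem gives `m₁` and `m₂`
  (`exists_isChaosProjection`), `M₁` and `M₂`.

* *Hilbert-Schmidt property.* With `S = ∑ |M₂ e|²` over finitely many orthonormal `e` one has
  `S = E[m₂ ∑ δ²(e ⊗ M₂ e)] ≤ ‖m₂‖ √(2 S)`, by Isserlis' formula and Bessel's inequality
  (`isHilbertSchmidt_meanHessian`).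

* *Convexity of `m₂`.* The second differences of a quadratic polynomial `F` along `H` are constants,
  given by `E[F δ²(x ⊗ x)]`; by quasi-invariance this passes to the `L²` limits
  (`hasConstSecondDiff_of_mem_polySpace`), and the convexity of `m₂` is the operator inequality.
-/

set_option linter.unusedSectionVars false

namespace WienerSpace

/-! ### Measures determined by their characteristic functions -/

/-- On a Polish vector space `V`, finite measures are determined by their characteristic function
along any space `D` of continuous linear functionals that separates points. No topology on `D` is
involved, so that `D` may be the dual of a space that is not normable. -/
theorem ext_of_integral_cexp_eq {V D : Type*} [AddCommGroup V] [Module ℝ V] [TopologicalSpace V]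
    [PolishSpace V] [MeasurableSpace V] [BorelSpace V] [AddCommGroup D] [Module ℝ D]
    (L : V →ₗ[ℝ] D →ₗ[ℝ] ℝ) (hL : ∀ d, Continuous fun v => L v d)
    (hsep : ∀ v ≠ 0, ∃ d, L v d ≠ 0) {P P' : Measure V} [IsFiniteMeasure P] [IsFiniteMeasure P']
    (h : ∀ d, ∫ v, Complex.exp (L v d * Complex.I) ∂P
      = ∫ v, Complex.exp (L v d * Complex.I) ∂P') : P = P' := by
  let := TopologicalSpace.upgradeIsCompletelyMetrizable V
  -- With the discrete topology on `D`, the pairing is jointly continuous.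
  let : TopologicalSpace D := ⊥
  have : DiscreteTopology D := ⟨rfl⟩
  refine ext_of_integral_char_eq (L := L) Real.continuous_probChar
    Real.probChar_ne_one ?_
    (continuous_prod_of_discrete_right.2 hL) ?_
  · intro v hv
    obtain ⟨d, hd⟩ := hsep v hv
    exact fun h0 => hd (by simp [h0])
  · intro d
    simpa [Real.probChar_apply] using h d

/-- A random variable whose moment generating function is Gaussian has a Gaussian law. -/
theorem map_eq_gaussianReal_of_mgf {Ω : Type*} [MeasurableSpace Ω] {P : Measure Ω}
    [IsProbabilityMeasure P] {X : Ω → ℝ} (hX : AEMeasurable X P) {a : ℝ} {v : ℝ≥0}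
    (h : ∀ t, mgf X P t = Real.exp (a * t + v * t ^ 2 / 2)) : P.map X = gaussianReal a v := by
  have h1 : mgf X P = mgf id (gaussianReal a v) := by
    rw [mgf_id_gaussianReal]; exact funext h
  have h2 := eqOn_complexMGF_of_mgf h1
  rw [integrableExpSet_eq_of_mgf h1, integrableExpSet_id_gaussianReal] at h2
  have h3 : complexMGF X P = complexMGF id (gaussianReal a v) := by
    funext z; exact h2 (by simp)
  simpa using Measure.ext_of_complexMGF_eq hX aemeasurable_id h3

/-! ### Moments of the real Gaussian law -/

theorem integral_pow_gaussianReal (v : ℝ≥0) :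
    ∫ x, x ^ 3 ∂gaussianReal 0 v = 0 ∧ ∫ x, x ^ 4 ∂gaussianReal 0 v = 3 * (v : ℝ) ^ 2 := by
  have hint : (0 : ℝ) ∈ interior (integrableExpSet id (gaussianReal 0 v)) := by
    simp [integrableExpSet_id_gaussianReal]
  set E : ℝ → ℝ := fun t => Real.exp (0 * t + v * t ^ 2 / 2) with hE
  have hE' : ∀ t, HasDerivAt E (v * t * E t) t := by
    intro t
    have : HasDerivAt (fun t : ℝ => 0 * t + v * t ^ 2 / 2) (v * t) t := by
      have := ((hasDerivAt_pow 2 t).const_mul (v : ℝ)).div_const 2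
      have h2 := ((hasDerivAt_id t).const_mul (0 : ℝ)).add this
      convert! h2 using 1
      simp; ring
    convert this.exp using 1
    simp [hE]; ring
  have hpoly : ∀ (p p' : ℝ → ℝ), (∀ t, HasDerivAt p (p' t) t) →
      deriv (fun t => p t * E t) = fun t => (p' t + v * t * p t) * E t := by
    intro p p' hp
    funext t
    refine ((hp t).mul (hE' t)).deriv.trans ?_
    ring
  have d0 : iteratedDeriv 0 E = fun t => 1 * E t := by simp
  have d1 : iteratedDeriv 1 E = fun t => (v * t) * E t := by
    rw [iteratedDeriv_succ, d0, hpoly (fun _ => 1) (fun _ => 0) (fun t => hasDerivAt_const t 1)]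
    funext t; ring
  have d2 : iteratedDeriv 2 E = fun t => (v + v ^ 2 * t ^ 2) * E t := by
    rw [iteratedDeriv_succ, d1, hpoly (fun t => v * t) (fun _ => v) (fun t => by
      simpa using (hasDerivAt_id t).const_mul (v : ℝ))]
    funext t; ring
  have d3 : iteratedDeriv 3 E = fun t => (3 * v ^ 2 * t + v ^ 3 * t ^ 3) * E t := by
    rw [iteratedDeriv_succ, d2, hpoly (fun t => v + v ^ 2 * t ^ 2) (fun t => 2 * v ^ 2 * t)
      (fun t => by
        have := ((hasDerivAt_pow 2 t).const_mul ((v : ℝ) ^ 2)).const_add (v : ℝ)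
        convert! this using 1
        simp; ring)]
    funext t; ring
  have d4 : iteratedDeriv 4 E
      = fun t => (3 * v ^ 2 + 6 * v ^ 3 * t ^ 2 + v ^ 4 * t ^ 4) * E t := by
    rw [iteratedDeriv_succ, d3, hpoly (fun t => 3 * v ^ 2 * t + v ^ 3 * t ^ 3)
      (fun t => 3 * v ^ 2 + 3 * v ^ 3 * t ^ 2)
      (fun t => by
        have := ((hasDerivAt_id t).const_mul (3 * (v : ℝ) ^ 2)).add
          ((hasDerivAt_pow 3 t).const_mul ((v : ℝ) ^ 3))
        convert! this using 1
        simp; ring)]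
    funext t; ring
  have key : ∀ n, ∫ x, x ^ n ∂gaussianReal 0 v = iteratedDeriv n E 0 := by
    intro n
    have := iteratedDeriv_mgf_zero hint n
    rw [mgf_id_gaussianReal] at this
    simpa [hE] using this.symm
  rw [key, key, d3, d4]
  simp [hE]

/-! ### Minkowski's inequality and product measures -/

section Product

variable {α β : Type*} [MeasurableSpace α] [MeasurableSpace β] {μ : Measure α} {ν : Measure β}

/-- Minkowski's integral inequality. -/
theorem lintegral_lintegral_rpow_le [SFinite μ] [IsFiniteMeasure ν] {q : ℝ} (hq : 1 ≤ q)
    {f : α → β → ℝ≥0∞} (hf : Measurable (Function.uncurry f)) :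
    ∫⁻ y, (∫⁻ x, f x y ∂μ) ^ q ∂ν ≤ (∫⁻ x, (∫⁻ y, f x y ^ q ∂ν) ^ (1 / q) ∂μ) ^ q := by
  rcases hq.eq_or_lt with rfl | hq1
  · simpa using (lintegral_lintegral_swap hf.aemeasurable).ge
  have hq0 : 0 < q := by linarith
  set A := ∫⁻ x, (∫⁻ y, f x y ^ q ∂ν) ^ (1 / q) ∂μ with hA
  set v : β → ℝ≥0∞ := fun y => ∫⁻ x, f x y ∂μ with hv
  have hvm : Measurable v := hf.lintegral_prod_left'
  -- The truncations `min v n` make the left-hand side finite, so that it may be cancelled.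
  have key : ∀ n : ℕ, ∫⁻ y, (min (v y) n) ^ q ∂ν ≤ A ^ q := by
    intro n
    set V := ∫⁻ y, (min (v y) n) ^ q ∂ν with hV
    have hVtop : V ≠ ⊤ := by
      refine ((lintegral_mono (g := fun _ => (n : ℝ≥0∞) ^ q) fun y =>
        ENNReal.rpow_le_rpow (min_le_right _ _) hq0.le).trans_lt ?_).ne
      rw [lintegral_const]
      exact ENNReal.mul_lt_top (ENNReal.rpow_lt_top_of_nonneg hq0.le (by simp))
        (measure_lt_top _ _)
    have hc : (q / (q - 1)).HolderConjugate q :=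
      (Real.HolderConjugate.conjExponent hq1).symm
    have h1 : V ≤ V ^ (1 / (q / (q - 1))) * A := by
      calc V = ∫⁻ y, (min (v y) n) ^ (q - 1) * min (v y) n ∂ν := by
            refine lintegral_congr fun y => ?_
            nth_rewrite 3 [← ENNReal.rpow_one (min (v y) n)]
            rw [← ENNReal.rpow_add_of_nonneg _ _ (by linarith) zero_le_one]
            simp
        _ ≤ ∫⁻ y, (min (v y) n) ^ (q - 1) * v y ∂ν :=
            lintegral_mono fun y => by gcongr; exact min_le_left _ _
        _ = ∫⁻ y, ∫⁻ x, (min (v y) n) ^ (q - 1) * f x y ∂μ ∂ν := by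
            refine lintegral_congr fun y => ?_
            rw [lintegral_const_mul _ hf.of_uncurry_right]
        _ = ∫⁻ x, ∫⁻ y, (min (v y) n) ^ (q - 1) * f x y ∂ν ∂μ := by
            refine lintegral_lintegral_swap ?_
            refine Measurable.aemeasurable ?_
            exact (((hvm.min measurable_const).pow_const _).comp measurable_fst).mul
              (hf.comp measurable_swap)
        _ ≤ ∫⁻ x, V ^ (1 / (q / (q - 1))) * (∫⁻ y, f x y ^ q ∂ν) ^ (1 / q) ∂μ := by
            refine lintegral_mono fun x => ?_
            have := ENNReal.lintegral_mul_le_Lp_mul_Lq ν hc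
              (f := fun y => (min (v y) n) ^ (q - 1)) (g := fun y => f x y)
              ((hvm.min measurable_const).pow_const _).aemeasurable
              hf.of_uncurry_left.aemeasurable
            refine this.trans_eq ?_
            congr 2
            refine lintegral_congr fun y => ?_
            rw [← ENNReal.rpow_mul]
            congr 1
            field_simp [(by linarith : q - 1 ≠ 0)]
        _ = V ^ (1 / (q / (q - 1))) * A := by
            rw [lintegral_const_mul]
            have : Measurable fun x => ∫⁻ y, f x y ^ q ∂ν :=
              (hf.pow_const q).lintegral_prod_right'
            exact this.pow_const _
    by_cases hV0 : V = 0
    · simp [hV0]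
    have h2 : V = V ^ (1 / (q / (q - 1))) * V ^ (1 / q) := by
      rw [← ENNReal.rpow_add _ _ hV0 hVtop]
      have : 1 / (q / (q - 1)) + 1 / q = 1 := by field_simp; ring
      rw [this, ENNReal.rpow_one]
    have h3 : V ^ (1 / q) ≤ A := by
      have h4 : V ^ (1 / (q / (q - 1))) * V ^ (1 / q) ≤ V ^ (1 / (q / (q - 1))) * A := h2 ▸ h1
      refine (ENNReal.mul_le_mul_iff_right ?_ ?_).1 h4
      · exact (ENNReal.rpow_pos (pos_iff_ne_zero.2 hV0) hVtop).ne'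
      · exact ENNReal.rpow_ne_top_of_nonneg (by have := hc.pos; positivity) hVtop
    calc V = (V ^ (1 / q)) ^ q := by
          rw [← ENNReal.rpow_mul, one_div_mul_cancel hq0.ne', ENNReal.rpow_one]
      _ ≤ A ^ q := ENNReal.rpow_le_rpow h3 hq0.le
  have hmono : Monotone fun (n : ℕ) (y : β) => (min (v y) n) ^ q := by
    intro n m hnm y
    exact ENNReal.rpow_le_rpow (min_le_min le_rfl (by exact_mod_cast hnm)) hq0.le
  have hlim : ∀ y, v y ^ q ≤ ⨆ n : ℕ, (min (v y) n) ^ q := by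
    intro y
    by_cases hy : v y = ⊤
    · simp only [hy, top_le_iff, min_eq_right, ENNReal.top_rpow_of_pos hq0, le_top]
      rw [iSup_eq_top]
      intro b hb
      obtain ⟨n, hn⟩ := ENNReal.exists_nat_gt hb.ne
      refine ⟨n + 1, hn.trans_le ?_⟩
      calc (n : ℝ≥0∞) ≤ ((n + 1 : ℕ) : ℝ≥0∞) := by exact_mod_cast Nat.le_succ n
        _ = ((n + 1 : ℕ) : ℝ≥0∞) ^ (1 : ℝ) := (ENNReal.rpow_one _).symm
        _ ≤ ((n + 1 : ℕ) : ℝ≥0∞) ^ q :=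
          ENNReal.rpow_le_rpow_of_exponent_le (by simp) hq
    · obtain ⟨n, hn⟩ := ENNReal.exists_nat_gt hy
      refine le_iSup_of_le n ?_
      rw [min_eq_left hn.le]
  calc ∫⁻ y, v y ^ q ∂ν ≤ ∫⁻ y, ⨆ n : ℕ, (min (v y) n) ^ q ∂ν := lintegral_mono hlim
    _ = ⨆ n : ℕ, ∫⁻ y, (min (v y) n) ^ q ∂ν :=
      lintegral_iSup (fun n => (hvm.min measurable_const).pow_const _) hmono
    _ ≤ A ^ q := iSup_le key

theorem eLpNorm_two_rpow_eq_lintegral (g : α → ℝ) :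
    eLpNorm g 2 μ ^ (2 : ℝ) = ∫⁻ x, ‖g x‖ₑ ^ (2 : ℝ) ∂μ := by
  simpa using eLpNorm_nnreal_pow_eq_lintegral (f := g) (μ := μ) (p := 2) (by norm_num)

/-- If every section of `G` in either variable satisfies `‖·‖_p ≤ K ‖·‖_2`, then so does `G`, with
the constant `K²`. -/
theorem eLpNorm_prod_le_of_sections [IsFiniteMeasure μ] [IsFiniteMeasure ν] {p : ℝ≥0} (hp : 2 ≤ p)
    {K : ℝ≥0} {G : α → β → ℝ} (hG : Measurable (Function.uncurry G))
    (h₁ : ∀ y, eLpNorm (fun x => G x y) p μ ≤ K * eLpNorm (fun x => G x y) 2 μ)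
    (h₂ : ∀ x, eLpNorm (fun y => G x y) p ν ≤ K * eLpNorm (fun y => G x y) 2 ν) :
    eLpNorm (Function.uncurry G) p (μ.prod ν)
      ≤ K ^ 2 * eLpNorm (Function.uncurry G) 2 (μ.prod ν) := by
  have hp0 : p ≠ 0 := fun h => by simp [h] at hp
  have hp0' : (0 : ℝ) < p := lt_of_le_of_ne p.2 (by exact_mod_cast hp0.symm)
  have hp2 : (2 : ℝ) ≤ p := by exact_mod_cast hp
  have hGm : Measurable (Function.uncurry fun x y => ‖G x y‖ₑ) := hG.enorm
  have hGm2 : Measurable fun x => ∫⁻ y, ‖G x y‖ₑ ^ (2 : ℝ) ∂ν :=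
    Measurable.lintegral_prod_right' (hGm.pow_const (2 : ℝ))
  have h2q : ∀ a : ℝ≥0∞, (a ^ (2 : ℝ)) ^ ((p : ℝ) / 2) = a ^ (p : ℝ) := fun a => by
    rw [← ENNReal.rpow_mul]; congr 1; ring
  have main : eLpNorm (Function.uncurry G) p (μ.prod ν) ^ (p : ℝ)
      ≤ (K ^ 2 * eLpNorm (Function.uncurry G) 2 (μ.prod ν)) ^ (p : ℝ) := by
    calc eLpNorm (Function.uncurry G) p (μ.prod ν) ^ (p : ℝ)
        = ∫⁻ z, ‖Function.uncurry G z‖ₑ ^ (p : ℝ) ∂μ.prod ν := eLpNorm_nnreal_pow_eq_lintegral hp0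
      _ = ∫⁻ y, ∫⁻ x, ‖G x y‖ₑ ^ (p : ℝ) ∂μ ∂ν :=
          lintegral_prod_symm' _ (hG.enorm.pow_const _)
      _ ≤ ∫⁻ y, K ^ (p : ℝ) * (∫⁻ x, ‖G x y‖ₑ ^ (2 : ℝ) ∂μ) ^ ((p : ℝ) / 2) ∂ν := by
          refine lintegral_mono fun y => ?_
          have := ENNReal.rpow_le_rpow (h₁ y) hp0'.le
          rwa [eLpNorm_nnreal_pow_eq_lintegral hp0, ENNReal.mul_rpow_of_nonneg _ _ hp0'.le,
            ← h2q (eLpNorm _ _ _), eLpNorm_two_rpow_eq_lintegral] at this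
      _ = K ^ (p : ℝ) * ∫⁻ y, (∫⁻ x, ‖G x y‖ₑ ^ (2 : ℝ) ∂μ) ^ ((p : ℝ) / 2) ∂ν := by
          rw [lintegral_const_mul]
          exact Measurable.pow_const (Measurable.lintegral_prod_left' (hGm.pow_const (2 : ℝ))) _
      _ ≤ K ^ (p : ℝ) * (∫⁻ x, (∫⁻ y, (‖G x y‖ₑ ^ (2 : ℝ)) ^ ((p : ℝ) / 2) ∂ν)
            ^ (1 / ((p : ℝ) / 2)) ∂μ) ^ ((p : ℝ) / 2) := by
          gcongr
          exact lintegral_lintegral_rpow_le (by linarith) (hGm.pow_const (2 : ℝ))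
      _ ≤ K ^ (p : ℝ) * (∫⁻ x, (K : ℝ≥0∞) ^ (2 : ℝ) * ∫⁻ y, ‖G x y‖ₑ ^ (2 : ℝ) ∂ν ∂μ)
            ^ ((p : ℝ) / 2) := by
          gcongr with x
          have := ENNReal.rpow_le_rpow (h₂ x) (zero_le_two (α := ℝ))
          rw [ENNReal.mul_rpow_of_nonneg _ _ (zero_le_two (α := ℝ)), eLpNorm_two_rpow_eq_lintegral] at this
          refine le_trans (le_of_eq ?_) this
          simp_rw [h2q]
          rw [← eLpNorm_nnreal_pow_eq_lintegral (f := fun y => G x y) hp0, ← ENNReal.rpow_mul]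
          congr 1
          field_simp
      _ = (K ^ 2 * eLpNorm (Function.uncurry G) 2 (μ.prod ν)) ^ (p : ℝ) := by
          have h3 : ∫⁻ x, ∫⁻ y, ‖G x y‖ₑ ^ (2 : ℝ) ∂ν ∂μ
              = eLpNorm (Function.uncurry G) 2 (μ.prod ν) ^ (2 : ℝ) := by
            rw [eLpNorm_two_rpow_eq_lintegral, lintegral_prod _ (hG.enorm.pow_const _).aemeasurable]
            rfl
          rw [lintegral_const_mul _ hGm2, h3,
            ENNReal.mul_rpow_of_nonneg _ _ (by positivity : (0 : ℝ) ≤ (p : ℝ) / 2), h2q, h2q,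
            ← mul_assoc, ← ENNReal.mul_rpow_of_nonneg _ _ hp0'.le,
            ← ENNReal.mul_rpow_of_nonneg _ _ hp0'.le, sq]
  exact (ENNReal.rpow_le_rpow_iff hp0').1 main

/-- Jensen's inequality: the oscillation of `f` around its mean is at most that between two
independent copies. -/
theorem eLpNorm_sub_integral_le [IsProbabilityMeasure μ] {p : ℝ≥0} (hp : 1 ≤ p)
    {f : α → ℝ} (hf : Measurable f) (hi : Integrable f μ) :
    eLpNorm (fun x => f x - ∫ y, f y ∂μ) p μ
      ≤ eLpNorm (fun z : α × α => f z.1 - f z.2) p (μ.prod μ) := by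
  have hp0 : p ≠ 0 := fun h => by simp [h] at hp
  have hp0' : (0 : ℝ) < p := lt_of_le_of_ne p.2 (by exact_mod_cast hp0.symm)
  rw [← ENNReal.rpow_le_rpow_iff hp0', eLpNorm_nnreal_pow_eq_lintegral hp0,
    eLpNorm_nnreal_pow_eq_lintegral hp0, lintegral_prod _ (by fun_prop)]
  refine lintegral_mono fun x => ?_
  rw [← eLpNorm_nnreal_pow_eq_lintegral (f := fun y => f x - f y) hp0]
  refine ENNReal.rpow_le_rpow ?_ hp0'.le
  have h1 : f x - ∫ y, f y ∂μ = ∫ y, (f x - f y) ∂μ := by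
    rw [integral_sub (integrable_const _) hi]; simp
  rw [h1]
  refine (enorm_integral_le_lintegral_enorm _).trans ?_
  rw [← eLpNorm_one_eq_lintegral_enorm]
  exact eLpNorm_le_eLpNorm_of_exponent_le (by exact_mod_cast hp)
    (measurable_const.sub hf).aestronglyMeasurable

end Product

/-! ### Elements of `L²` and Gaussian variables -/

section L2

variable {Ω : Type*} [MeasurableSpace Ω] {μ : Measure Ω}

theorem real_inner_Lp_eq_integral (F G : Lp ℝ 2 μ) : ⟪F, G⟫_ℝ = ∫ w, F w * G w ∂μ := by
  rw [L2.inner_def]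
  refine integral_congr_ae (.of_forall fun w => ?_)
  simp [mul_comm]

theorem integrable_mul_Lp (F G : Lp ℝ 2 μ) : Integrable (fun w => F w * G w) μ :=
  (Lp.memLp F).integrable_mul (Lp.memLp G)

theorem exists_seq_ae_tendsto_of_tendsto_Lp {f : ℕ → Lp ℝ 2 μ} {g : Lp ℝ 2 μ}
    (h : Filter.Tendsto f Filter.atTop (nhds g)) :
    ∃ ns : ℕ → ℕ, StrictMono ns ∧
      ∀ᵐ w ∂μ, Filter.Tendsto (fun n => f (ns n) w) Filter.atTop (nhds (g w)) :=
  (tendstoInMeasure_of_tendsto_Lp h).exists_seq_tendsto_ae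

theorem eLpNorm_of_map_eq_gaussianReal {X : Ω → ℝ} (hX : AEMeasurable X μ) {σ : ℝ≥0}
    (h : μ.map X = gaussianReal 0 (σ ^ 2)) (p : ℝ≥0∞) :
    eLpNorm X p μ = σ * eLpNorm id p (gaussianReal 0 1) := by
  have h1 : gaussianReal 0 (σ ^ 2) = (gaussianReal 0 1).map ((σ : ℝ) * ·) := by
    rw [gaussianReal_map_const_mul]
    congr 1
    · simp
    · ext; simp
  have h2 : eLpNorm X p μ = eLpNorm id p (μ.map X) :=
    (eLpNorm_map_measure aestronglyMeasurable_id hX).symm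
  rw [h2, h, h1, eLpNorm_map_measure aestronglyMeasurable_id (by fun_prop)]
  have h3 : (id ∘ ((σ : ℝ) * ·) : ℝ → ℝ) = (σ : ℝ) • (id : ℝ → ℝ) := by ext; simp
  rw [h3, eLpNorm_const_smul]
  simp [enorm_eq_nnnorm]

theorem memLp_of_map_eq_gaussianReal {X : Ω → ℝ} (hX : AEMeasurable X μ) {a : ℝ} {v : ℝ≥0}
    (h : μ.map X = gaussianReal a v) {p : ℝ≥0∞} (hp : p ≠ ⊤) : MemLp X p μ := by
  have := memLp_id_gaussianReal' (μ := a) (v := v) p hp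
  rw [← h] at this
  exact (memLp_map_measure_iff aestronglyMeasurable_id hX).1 this

end L2

/-! ### The chaos spaces -/

section Chaos

variable {W : Type*} [AddCommGroup W] [Module ℝ W] [TopologicalSpace W] [MeasurableSpace W]
  {μ : Measure W}

theorem polySpace_mono {n m : ℕ} (h : n ≤ m) : polySpace μ n ≤ polySpace μ m :=
  Submodule.topologicalClosure_mono (Submodule.span_mono
    fun _ ⟨k, hk, hF⟩ => ⟨k, hk.trans h, hF⟩)

theorem chaos_le_polySpace (n : ℕ) : chaos μ n ≤ polySpace μ n := by
  cases n with
  | zero => exact le_rfl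
  | succ n => exact inf_le_left

theorem isClosed_polySpace (n : ℕ) : IsClosed (polySpace μ n : Set (Lp ℝ 2 μ)) :=
  Submodule.isClosed_topologicalClosure _

theorem isClosed_chaos (n : ℕ) : IsClosed (chaos μ n : Set (Lp ℝ 2 μ)) := by
  cases n with
  | zero => exact isClosed_polySpace 0
  | succ n => exact (isClosed_polySpace _).inter (Submodule.isClosed_orthogonal _)

theorem inner_eq_zero_of_mem_chaos_of_lt {k n : ℕ} (hkn : k < n) {u f : Lp ℝ 2 μ}
    (hu : u ∈ chaos μ k) (hf : f ∈ chaos μ n) : ⟪u, f⟫_ℝ = 0 := by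
  obtain ⟨n, rfl⟩ : ∃ m, n = m + 1 := ⟨n - 1, by omega⟩
  exact Submodule.inner_right_of_mem_orthogonal
    (polySpace_mono (Nat.lt_succ_iff.1 hkn) (chaos_le_polySpace k hu)) hf.2

theorem inner_eq_zero_of_mem_chaos {k n : ℕ} (hkn : k ≠ n) {u f : Lp ℝ 2 μ}
    (hu : u ∈ chaos μ k) (hf : f ∈ chaos μ n) : ⟪u, f⟫_ℝ = 0 := by
  rcases hkn.lt_or_gt with h | h
  · exact inner_eq_zero_of_mem_chaos_of_lt h hu hf
  · rw [real_inner_comm]; exact inner_eq_zero_of_mem_chaos_of_lt h hf hu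

theorem isBesselPow_of_mem_chaos (s : ℝ) {n : ℕ} {f : Lp ℝ 2 μ} (hf : f ∈ chaos μ n) :
    IsBesselPow μ s f ((1 + n : ℝ) ^ (s / 2) • f) := by
  intro k u hu
  rw [real_inner_smul_right]
  by_cases hkn : k = n
  · rw [hkn]
  · rw [inner_eq_zero_of_mem_chaos hkn hu hf, mul_zero, mul_zero]

theorem mem_polySpace_orthogonal {n : ℕ} {F : Lp ℝ 2 μ}
    (h : ∀ k ≤ n, ∀ ℓ : Fin k → W →L[ℝ] ℝ, ∫ w, F w * ∏ j, ℓ j w ∂μ = 0) :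
    F ∈ (polySpace μ n)ᗮ := by
  have h1 : polySpace μ n ≤ (Submodule.span ℝ {F})ᗮ := by
    refine Submodule.topologicalClosure_minimal _ (Submodule.span_le.2 ?_)
      (Submodule.isClosed_orthogonal _)
    rintro G ⟨k, hk, ℓ, hG⟩
    rw [SetLike.mem_coe, Submodule.mem_orthogonal_singleton_iff_inner_right,
      real_inner_Lp_eq_integral, ← h k hk ℓ]
    refine integral_congr_ae ?_
    filter_upwards [hG] with w hw
    rw [hw]
  intro G hG
  rw [real_inner_comm]
  exact Submodule.mem_orthogonal_singleton_iff_inner_right.1 (h1 hG)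

end Chaos

/-! ### Derivatives along a line -/

section Calculus

variable {E F : Type*} [NormedAddCommGroup E] [NormedSpace ℝ E] [NormedAddCommGroup F]
  [NormedSpace ℝ F]

theorem hasDerivAt_iteratedFDeriv_line {g : E → F} (hg : ContDiff ℝ ∞ g) (m : ℕ)
    (x v : E) (u : Fin m → E) (t : ℝ) :
    HasDerivAt (fun t : ℝ => iteratedFDeriv ℝ m g (x + t • v) u)
      (iteratedFDeriv ℝ (m + 1) g (x + t • v) (Fin.cons v u)) t := by
  have h1 : HasFDerivAt (iteratedFDeriv ℝ m g) (fderiv ℝ (iteratedFDeriv ℝ m g) (x + t • v))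
      (x + t • v) :=
    (hg.differentiable_iteratedFDeriv (by exact_mod_cast WithTop.coe_lt_top m) _).hasFDerivAt
  have h2 : HasDerivAt (fun t : ℝ => x + t • v) v t := by
    simpa using ((hasDerivAt_id t).smul_const v).const_add x
  have h3 := (ContinuousMultilinearMap.apply ℝ (fun _ : Fin m => E) F u).hasFDerivAt.comp_hasDerivAt
    t (h1.comp_hasDerivAt t h2)
  rw [iteratedFDeriv_succ_apply_left]
  simpa using! h3

theorem grad_comp_eq {W H : Type*} [AddCommGroup W] [Module ℝ W] [TopologicalSpace W]
    [NormedAddCommGroup H] [InnerProductSpace ℝ H] (i : H →L[ℝ] W) (Λ : W →L[ℝ] E) {g : E → ℝ}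
    (hg : ContDiff ℝ ∞ g) (m : ℕ) (w : W) (h : Fin m → H) :
    grad i m (fun w => g (Λ w)) w h = iteratedFDeriv ℝ m g (Λ w) fun j => Λ (i (h j)) := by
  have h1 : (fun x : H => g (Λ (w + i x))) = (fun y => g (Λ w + y)) ∘ (Λ.comp i) := by
    ext x; simp
  have h2 : ContDiff ℝ ∞ fun y => g (Λ w + y) := hg.comp (contDiff_const.add contDiff_id)
  rw [grad, h1, (Λ.comp i).iteratedFDeriv_comp_right h2 0 (i := m)
    (by exact_mod_cast (WithTop.coe_lt_top m).le), iteratedFDeriv_comp_add_left]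
  simp

end Calculus

/-! ### The adjoint of the injection -/

section Adjoint

variable {W H : Type*} [AddCommGroup W] [Module ℝ W] [TopologicalSpace W]
  [NormedAddCommGroup H] [InnerProductSpace ℝ H] [CompleteSpace H]

/-- The adjoint `i* : W* → H` of the injection `i : H → W`. -/
noncomputable def adj (i : H →L[ℝ] W) : (W →L[ℝ] ℝ) →ₗ[ℝ] H where
  toFun ℓ := (InnerProductSpace.toDual ℝ H).symm (ℓ.comp i)
  map_add' ℓ ℓ' := by rw [← map_add]; rfl
  map_smul' c ℓ := by
    refine ext_inner_right ℝ fun h => ?_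
    simp [inner_smul_left]

theorem inner_adj (i : H →L[ℝ] W) (ℓ : W →L[ℝ] ℝ) (h : H) : ⟪adj i ℓ, h⟫_ℝ = ℓ (i h) := by
  simp [adj]

theorem nnnorm_adj (i : H →L[ℝ] W) (ℓ : W →L[ℝ] ℝ) : ‖adj i ℓ‖₊ = ‖ℓ.comp i‖₊ := by
  simp [adj]

theorem denseRange_adj [SeparatingDual ℝ W] {i : H →L[ℝ] W} (hi : Function.Injective i) :
    DenseRange (adj i) := by
  have h : (LinearMap.range (adj i)).topologicalClosure = ⊤ := by
    rw [Submodule.topologicalClosure_eq_top_iff, Submodule.eq_bot_iff]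
    intro h hh
    by_contra hne
    obtain ⟨ℓ, hℓ⟩ := SeparatingDual.exists_ne_zero (R := ℝ) (x := i h)
      (fun h0 => hne (hi (by simpa using h0)))
    rw [← inner_adj] at hℓ
    exact hℓ (hh _ ⟨ℓ, rfl⟩)
  have := Submodule.dense_iff_topologicalClosure_eq_top.2 h
  rwa [LinearMap.coe_range] at this

end Adjoint

variable {W H : Type*} [AddCommGroup W] [Module ℝ W] [TopologicalSpace W] [IsTopologicalAddGroup W]
  [ContinuousSMul ℝ W] [LocallyConvexSpace ℝ W] [PolishSpace W] [MeasurableSpace W] [BorelSpace W]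
  [NormedAddCommGroup H] [InnerProductSpace ℝ H] [CompleteSpace H] {i : H →L[ℝ] W} {μ : Measure W}

/-! ### The Paley-Wiener map -/

theorem IsAbstractWienerSpace.map_dual_eq (hW : IsAbstractWienerSpace i μ) (ℓ : W →L[ℝ] ℝ) :
    μ.map ℓ = gaussianReal 0 (‖adj i ℓ‖₊ ^ 2) := by
  rw [hW.map_dual, nnnorm_adj]

theorem IsAbstractWienerSpace.memLp_dual (hW : IsAbstractWienerSpace i μ) (ℓ : W →L[ℝ] ℝ)
    {p : ℝ≥0∞} (hp : p ≠ ⊤) : MemLp ℓ p μ :=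
  memLp_of_map_eq_gaussianReal ℓ.continuous.measurable.aemeasurable (hW.map_dual ℓ) hp

/-- The elements of `W*` as elements of `L²(μ)`. -/
noncomputable def dualToLp (hW : IsAbstractWienerSpace i μ) : (W →L[ℝ] ℝ) →ₗ[ℝ] Lp ℝ 2 μ where
  toFun ℓ := (hW.memLp_dual ℓ (p := 2) (by simp)).toLp ℓ
  map_add' _ _ := rfl
  map_smul' _ _ := rfl

theorem coeFn_dualToLp (hW : IsAbstractWienerSpace i μ) (ℓ : W →L[ℝ] ℝ) :
    dualToLp hW ℓ =ᵐ[μ] ℓ :=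
  (hW.memLp_dual ℓ (p := 2) (by simp)).coeFn_toLp

theorem norm_dualToLp (hW : IsAbstractWienerSpace i μ) (ℓ : W →L[ℝ] ℝ) :
    ‖dualToLp hW ℓ‖ = ‖adj i ℓ‖ := by
  have h : ‖dualToLp hW ℓ‖ ^ 2 = ‖adj i ℓ‖ ^ 2 := by
    rw [← real_inner_self_eq_norm_sq, real_inner_Lp_eq_integral]
    have h1 : ∫ w, dualToLp hW ℓ w * dualToLp hW ℓ w ∂μ = ∫ x, x ^ 2 ∂(μ.map ℓ) := by
      rw [integral_map ℓ.continuous.measurable.aemeasurable (by fun_prop)]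
      refine integral_congr_ae ?_
      filter_upwards [coeFn_dualToLp hW ℓ] with w hw
      rw [hw]; ring
    have h2 := variance_fun_id_gaussianReal (μ := 0) (v := ‖adj i ℓ‖₊ ^ 2)
    rw [variance_eq_integral (by fun_prop), integral_id_gaussianReal] at h2
    rw [h1, hW.map_dual_eq]
    simpa using h2
  exact (pow_left_inj₀ (norm_nonneg _) (norm_nonneg _) two_ne_zero).1 h

/-- The Paley-Wiener map `h ↦ δh`: the isometry from `H` to `L²(μ)` which sends `i* ℓ` to `ℓ` for
`ℓ ∈ W*`. -/
noncomputable def paleyWiener (hW : IsAbstractWienerSpace i μ) : H →L[ℝ] Lp ℝ 2 μ :=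
  (dualToLp hW).extendOfNorm (adj i)

theorem paleyWiener_adj (hW : IsAbstractWienerSpace i μ) (ℓ : W →L[ℝ] ℝ) :
    paleyWiener hW (adj i ℓ) = dualToLp hW ℓ :=
  LinearMap.extendOfNorm_eq (denseRange_adj hW.injective)
    ⟨1, fun ℓ => by rw [norm_dualToLp, one_mul]⟩ ℓ

theorem paleyWiener_adj_ae (hW : IsAbstractWienerSpace i μ) (ℓ : W →L[ℝ] ℝ) :
    paleyWiener hW (adj i ℓ) =ᵐ[μ] ℓ := by
  rw [paleyWiener_adj]; exact coeFn_dualToLp hW ℓ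

theorem norm_paleyWiener (hW : IsAbstractWienerSpace i μ) (h : H) : ‖paleyWiener hW h‖ = ‖h‖ := by
  refine (denseRange_adj hW.injective).induction_on h
    (isClosed_eq (by fun_prop) (by fun_prop)) fun ℓ => ?_
  rw [paleyWiener_adj, norm_dualToLp]

theorem inner_paleyWiener (hW : IsAbstractWienerSpace i μ) (h k : H) :
    ⟪paleyWiener hW h, paleyWiener hW k⟫_ℝ = ⟪h, k⟫_ℝ :=
  LinearIsometry.inner_map_map
    (⟨(paleyWiener hW).toLinearMap, norm_paleyWiener hW⟩ : H →ₗᵢ[ℝ] Lp ℝ 2 μ) h k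

theorem integral_paleyWiener_mul (hW : IsAbstractWienerSpace i μ) (h k : H) :
    ∫ w, paleyWiener hW h w * paleyWiener hW k w ∂μ = ⟪h, k⟫_ℝ := by
  rw [← real_inner_Lp_eq_integral, inner_paleyWiener]

/-- Every `h ∈ H` is the limit of a sequence `i* ℓₙ` along which also `ℓₙ → δh` almost surely. -/
theorem exists_seq_adj_tendsto (hW : IsAbstractWienerSpace i μ) (h : H) :
    ∃ ℓ : ℕ → W →L[ℝ] ℝ,
      Filter.Tendsto (fun n => adj i (ℓ n)) Filter.atTop (nhds h) ∧
      ∀ᵐ w ∂μ, Filter.Tendsto (fun n => ℓ n w) Filter.atTop (nhds (paleyWiener hW h w)) := by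
  obtain ⟨x, hx, hlim⟩ := mem_closure_iff_seq_limit.1 (denseRange_adj hW.injective h)
  choose ℓ hℓ using hx
  obtain rfl : x = fun n => adj i (ℓ n) := funext fun n => (hℓ n).symm
  obtain ⟨ns, hns, hae⟩ := exists_seq_ae_tendsto_of_tendsto_Lp
    (((paleyWiener hW).continuous.tendsto h).comp hlim)
  refine ⟨fun n => ℓ (ns n), hlim.comp hns.tendsto_atTop, ?_⟩
  have : ∀ᵐ w ∂μ, ∀ n, paleyWiener hW (adj i (ℓ n)) w = ℓ n w :=
    ae_all_iff.2 fun n => paleyWiener_adj_ae hW (ℓ n)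
  filter_upwards [hae, this] with w h1 h2
  simpa [h2] using h1

theorem map_paleyWiener [IsProbabilityMeasure μ] (hW : IsAbstractWienerSpace i μ) (h : H) :
    μ.map (paleyWiener hW h) = gaussianReal 0 (‖h‖₊ ^ 2) := by
  have hm : AEMeasurable (paleyWiener hW h) μ := (Lp.aestronglyMeasurable _).aemeasurable
  have : IsProbabilityMeasure (μ.map (paleyWiener hW h)) :=
    Measure.isProbabilityMeasure_map hm
  refine Measure.ext_of_charFun (funext fun t => ?_)
  obtain ⟨ℓ, hℓ, hae⟩ := exists_seq_adj_tendsto hW h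
  have h1 : Filter.Tendsto (fun n => charFun (μ.map (ℓ n)) t) Filter.atTop
      (nhds (charFun (μ.map (paleyWiener hW h)) t)) := by
    simp_rw [charFun_apply_real]
    rw [integral_map hm (by fun_prop)]
    simp_rw [fun n => integral_map (μ := μ) (ℓ n).continuous.measurable.aemeasurable
      (f := fun x : ℝ => Complex.exp (t * x * Complex.I)) (by fun_prop)]
    refine tendsto_integral_of_dominated_convergence (fun _ => 1) (fun n => ?_)
      (integrable_const _) (fun n => .of_forall fun w => ?_) ?_
    · have := (ℓ n).continuous.measurable
      fun_prop
    · rw [← Complex.ofReal_mul, Complex.norm_exp_ofReal_mul_I]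
    · filter_upwards [hae] with w hw
      have hc : Continuous fun x : ℝ => Complex.exp (t * x * Complex.I) := by fun_prop
      exact (hc.tendsto _).comp hw
  have h2 : Filter.Tendsto (fun n => charFun (μ.map (ℓ n)) t) Filter.atTop
      (nhds (charFun (gaussianReal 0 (‖h‖₊ ^ 2)) t)) := by
    simp_rw [hW.map_dual_eq, charFun_gaussianReal]
    have hc : Continuous fun x : H =>
        Complex.exp (t * (0 : ℝ) * Complex.I - ((‖x‖₊ ^ 2 : ℝ≥0) : ℝ) * t ^ 2 / 2) := by
      simp only [NNReal.coe_pow, coe_nnnorm]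
      fun_prop
    exact (hc.tendsto _).comp hℓ
  exact tendsto_nhds_unique h1 h2

theorem memLp_paleyWiener [IsProbabilityMeasure μ] (hW : IsAbstractWienerSpace i μ) (h : H)
    {p : ℝ≥0∞} (hp : p ≠ ⊤) : MemLp (paleyWiener hW h) p μ :=
  memLp_of_map_eq_gaussianReal (Lp.aestronglyMeasurable _).aemeasurable (map_paleyWiener hW h) hp

/-! ### The Cameron-Martin theorem -/

theorem mgf_paleyWiener [IsProbabilityMeasure μ] (hW : IsAbstractWienerSpace i μ) (h : H) (t : ℝ) :
    mgf (paleyWiener hW h) μ t = Real.exp (‖h‖ ^ 2 * t ^ 2 / 2) := by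
  rw [mgf_gaussianReal (map_paleyWiener hW h)]; simp

theorem integrable_exp_paleyWiener [IsProbabilityMeasure μ] (hW : IsAbstractWienerSpace i μ)
    (h : H) (t : ℝ) : Integrable (fun w => Real.exp (t * paleyWiener hW h w)) μ := by
  by_contra hc
  have h1 := mgf_paleyWiener hW h t
  rw [mgf, integral_undef hc] at h1
  exact (Real.exp_pos _).ne h1

/-- The Cameron-Martin density `exp(δh - |h|²/2)`. -/
noncomputable def cmDensity (hW : IsAbstractWienerSpace i μ) (h : H) (w : W) : ℝ :=
  Real.exp (paleyWiener hW h w - ‖h‖ ^ 2 / 2)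

theorem measurable_paleyWiener (hW : IsAbstractWienerSpace i μ) (h : H) :
    Measurable (paleyWiener hW h) := (Lp.stronglyMeasurable _).measurable

theorem measurable_cmDensity (hW : IsAbstractWienerSpace i μ) (h : H) :
    Measurable (cmDensity hW h) :=
  ((measurable_paleyWiener hW h).sub_const _).exp

theorem integrable_cmDensity [IsProbabilityMeasure μ] (hW : IsAbstractWienerSpace i μ) (h : H) :
    Integrable (cmDensity hW h) μ := by
  have := (integrable_exp_paleyWiener hW h 1).mul_const (Real.exp (-(‖h‖ ^ 2 / 2)))
  refine this.congr (.of_forall fun w => ?_)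
  simp [cmDensity, ← Real.exp_add, sub_eq_add_neg]

theorem integral_cmDensity_mul_exp [IsProbabilityMeasure μ] (hW : IsAbstractWienerSpace i μ)
    (h k : H) : ∫ w, cmDensity hW h w * Real.exp (paleyWiener hW k w) ∂μ
      = Real.exp (⟪h, k⟫_ℝ + ‖k‖ ^ 2 / 2) := by
  have h1 : ∀ᵐ w ∂μ, cmDensity hW h w * Real.exp (paleyWiener hW k w)
      = Real.exp (-(‖h‖ ^ 2 / 2)) * Real.exp (1 * paleyWiener hW (h + k) w) := by
    have : paleyWiener hW (h + k) =ᵐ[μ] paleyWiener hW h + paleyWiener hW k := by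
      rw [map_add]; exact Lp.coeFn_add _ _
    filter_upwards [this] with w hw
    rw [hw, cmDensity, ← Real.exp_add, ← Real.exp_add, Pi.add_apply]
    ring_nf
  rw [integral_congr_ae h1, integral_const_mul]
  have := mgf_paleyWiener hW (h + k) 1
  rw [mgf] at this
  rw [this, ← Real.exp_add, norm_add_sq_real]
  ring_nf

theorem measurable_add_right_const (x : W) : Measurable fun w : W => w + x :=
  (continuous_id.add continuous_const).measurable

/-- The Cameron-Martin theorem. -/
theorem map_add_eq_withDensity [IsProbabilityMeasure μ] (hW : IsAbstractWienerSpace i μ) (h : H) :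
    μ.map (fun w => w + i h) = μ.withDensity fun w => ENNReal.ofReal (cmDensity hW h w) := by
  set ν := μ.withDensity fun w => ENNReal.ofReal (cmDensity hW h w) with hν
  have hD0 : ∀ w, 0 ≤ cmDensity hW h w := fun w => (Real.exp_pos _).le
  have hint : ∀ f : W → ℝ, ∫ w, f w ∂ν = ∫ w, cmDensity hW h w * f w ∂μ := by
    intro f
    rw [hν, integral_withDensity_eq_integral_toReal_smul
      (measurable_cmDensity hW h).ennreal_ofReal (by simp)]
    simp [ENNReal.toReal_ofReal, hD0]
  have hνp : IsProbabilityMeasure ν := by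
    refine ⟨?_⟩
    rw [hν, withDensity_apply _ .univ, setLIntegral_univ,
      ← ofReal_integral_eq_lintegral_ofReal (integrable_cmDensity hW h) (.of_forall hD0)]
    have := integral_cmDensity_mul_exp hW h 0
    have h1 : ∫ w, cmDensity hW h w ∂μ = 1 := by
      rw [← show Real.exp (⟪h, (0 : H)⟫_ℝ + ‖(0 : H)‖ ^ 2 / 2) = 1 by simp, ← this]
      exact integral_congr_ae (.of_forall fun w => by simp)
    simp [h1]
  have hmp : IsProbabilityMeasure (μ.map fun w => w + i h) :=
    Measure.isProbabilityMeasure_map (measurable_add_right_const _).aemeasurable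
  refine ext_of_integral_cexp_eq
    (LinearMap.mk₂ ℝ (fun (w : W) (ℓ : W →L[ℝ] ℝ) => ℓ w) (by simp) (by simp) (by simp) (by simp))
    (fun ℓ => ℓ.continuous) (fun w hw => SeparatingDual.exists_ne_zero hw) fun ℓ => ?_
  have hℓ := ℓ.continuous.measurable
  have e1 : ν.map ℓ = gaussianReal (ℓ (i h)) (‖adj i ℓ‖₊ ^ 2) := by
    refine map_eq_gaussianReal_of_mgf hℓ.aemeasurable fun t => ?_
    rw [mgf, hint]
    have : (fun w => cmDensity hW h w * Real.exp (t * ℓ w))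
        =ᵐ[μ] fun w => cmDensity hW h w * Real.exp (paleyWiener hW (adj i (t • ℓ)) w) := by
      filter_upwards [paleyWiener_adj_ae hW (t • ℓ)] with w hw
      rw [hw]; simp
    rw [integral_congr_ae this, integral_cmDensity_mul_exp, real_inner_comm, inner_adj, map_smul,
      norm_smul]
    simp [mul_pow]
    ring_nf
  have e2 : (μ.map fun w => w + i h).map ℓ = gaussianReal (ℓ (i h)) (‖adj i ℓ‖₊ ^ 2) := by
    rw [Measure.map_map hℓ (measurable_add_right_const _)]
    have : (ℓ ∘ fun w => w + i h) = (fun x => x + ℓ (i h)) ∘ ℓ := by ext; simp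
    rw [this, ← Measure.map_map (by fun_prop) hℓ, hW.map_dual_eq, gaussianReal_map_add_const,
      zero_add]
  have e3 := fun (ρ : Measure W) => integral_map (μ := ρ) hℓ.aemeasurable
    (f := fun x : ℝ => Complex.exp (x * Complex.I)) (by fun_prop)
  simp only [LinearMap.mk₂_apply]
  rw [← e3, ← e3, e1, e2]

/-- Almost sure statements are preserved by translations in the directions of `H`. -/
theorem ae_shift [IsProbabilityMeasure μ] (hW : IsAbstractWienerSpace i μ) (h : H) {P : W → Prop}
    (hP : ∀ᵐ w ∂μ, P w) : ∀ᵐ w ∂μ, P (w + i h) := by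
  have h1 : μ.map (fun w => w + i h) ≪ μ := by
    rw [map_add_eq_withDensity hW]; exact withDensity_absolutelyContinuous _ _
  exact ae_of_ae_map (measurable_add_right_const _).aemeasurable (h1.ae_le hP)

theorem integral_shift [IsProbabilityMeasure μ] (hW : IsAbstractWienerSpace i μ) (h : H)
    (G : W → ℝ) : ∫ w, G (w + i h) ∂μ = ∫ w, cmDensity hW h w * G w ∂μ := by
  have := map_add_eq_withDensity hW h
  refine ((Homeomorph.addRight (i h)).measurableEmbedding.integral_map (μ := μ) G).symm.trans ?_
  rw [show (⇑(Homeomorph.addRight (i h)) : W → W) = fun w => w + i h from rfl, this,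
    integral_withDensity_eq_integral_toReal_smul
      (measurable_cmDensity hW h).ennreal_ofReal (by simp)]
  refine integral_congr_ae (.of_forall fun w => ?_)
  simp [ENNReal.toReal_ofReal, (Real.exp_pos _).le, cmDensity]

theorem paleyWiener_shift [IsProbabilityMeasure μ] (hW : IsAbstractWienerSpace i μ) (h k : H) :
    ∀ᵐ w ∂μ, paleyWiener hW h (w + i k) = paleyWiener hW h w + ⟪h, k⟫_ℝ := by
  obtain ⟨ℓ, hℓ, hae⟩ := exists_seq_adj_tendsto hW h
  filter_upwards [hae, ae_shift hW k hae] with w h1 h2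
  refine tendsto_nhds_unique h2 ?_
  have h3 : Filter.Tendsto (fun n => ⟪adj i (ℓ n), k⟫_ℝ) Filter.atTop (nhds ⟪h, k⟫_ℝ) :=
    hℓ.inner tendsto_const_nhds
  simpa [inner_adj] using h1.add h3

/-! ### Integration by parts -/

theorem memLp_exp_abs_paleyWiener [IsProbabilityMeasure μ] (hW : IsAbstractWienerSpace i μ)
    (k : H) : MemLp (fun w => Real.exp (2 * |paleyWiener hW k w|)) 2 μ := by
  have hm := (measurable_paleyWiener hW k).abs
  rw [memLp_two_iff_integrable_sq (by fun_prop)]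
  have := integrable_exp_mul_abs (integrable_exp_paleyWiener hW k 4)
    (integrable_exp_paleyWiener hW k (-4))
  refine this.congr (.of_forall fun w => ?_)
  simp only [← Real.exp_nat_mul]
  congr 1
  push_cast; ring

/-- Integration by parts against a functional `G` which is affine along the direction `k`. It is
the derivative at `t = 0` of `E[G ψ(· + t k)]`, computed also by the Cameron-Martin theorem. -/
theorem integral_mul_deriv_eq [IsProbabilityMeasure μ] (hW : IsAbstractWienerSpace i μ) (k : H)
    {G ψ ψ' : W → ℝ} {c C : ℝ} (hG : MemLp G 2 μ)
    (hshift : ∀ t : ℝ, ∀ᵐ w ∂μ, G (w + i (t • k)) = G w + t * c)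
    (hψm : Measurable ψ) (hψm' : Measurable ψ') (hψ : ∀ w, |ψ w| ≤ C) (hψ' : ∀ w, |ψ' w| ≤ C)
    (hder : ∀ w (t : ℝ),
      HasDerivAt (fun t : ℝ => ψ (w + i (t • k))) (ψ' (w + i (t • k))) t) :
    ∫ w, G w * ψ' w ∂μ = ∫ w, (G w * paleyWiener hW k w - c) * ψ w ∂μ := by
  have hC : 0 ≤ C := (abs_nonneg _).trans (hψ 0)
  set P := paleyWiener hW k with hP
  have hPm : Measurable P := measurable_paleyWiener hW k
  have hGi : Integrable G μ := hG.integrable (by norm_num)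
  have hball : Metric.ball (0 : ℝ) 1 ∈ nhds (0 : ℝ) := Metric.ball_mem_nhds _ one_pos
  -- the derivative of the left-hand side
  have d1 : HasDerivAt (fun t : ℝ => ∫ w, G w * ψ (w + i (t • k)) ∂μ)
      (∫ w, G w * ψ' (w + i ((0 : ℝ) • k)) ∂μ) 0 := by
    refine (hasDerivAt_integral_of_dominated_loc_of_deriv_le hball
      (F' := fun t w => G w * ψ' (w + i (t • k))) (bound := fun w => |G w| * C)
      (.of_forall fun t => ?_) ?_ ?_ ?_ (hGi.abs.mul_const C) ?_).2
    · exact hG.1.mul (hψm.comp (measurable_add_right_const _)).aestronglyMeasurable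
    · exact hGi.mul_bdd (c := C) (hψm.comp (measurable_add_right_const _)).aestronglyMeasurable
        (.of_forall fun w => hψ _)
    · exact hG.1.mul (hψm'.comp (measurable_add_right_const _)).aestronglyMeasurable
    · refine .of_forall fun w t _ => ?_
      rw [norm_mul, Real.norm_eq_abs]
      exact mul_le_mul_of_nonneg_left (hψ' _) (abs_nonneg _)
    · exact .of_forall fun w t _ => (hder w t).const_mul _
  -- the derivative of the right-hand side
  set D : ℝ → W → ℝ := fun t w => Real.exp (t * P w - t ^ 2 * ‖k‖ ^ 2 / 2) with hD
  have hDm : ∀ t, Measurable (D t) := fun t => by fun_prop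
  have d2 : HasDerivAt (fun t : ℝ => ∫ w, D t w * ((G w - t * c) * ψ w) ∂μ)
      (∫ w, (G w * P w - c) * ψ w ∂μ) 0 := by
    have hexp := memLp_exp_abs_paleyWiener hW k
    have hGc : MemLp (fun w => |G w| + |c|) 2 μ := hG.abs.add (memLp_const _)
    have hb : Integrable (fun w => C * ((1 + ‖k‖ ^ 2) * (Real.exp (2 * |P w|) * (|G w| + |c|))
        + |c| * Real.exp (2 * |P w|))) μ :=
      (((hexp.integrable_mul hGc).const_mul _).add
        ((hexp.integrable (by norm_num)).const_mul _)).const_mul _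
    have := (hasDerivAt_integral_of_dominated_loc_of_deriv_le (μ := μ) hball
      (F := fun t w => D t w * ((G w - t * c) * ψ w))
      (F' := fun t w => ((P w - t * ‖k‖ ^ 2) * (G w - t * c) - c) * D t w * ψ w)
      (.of_forall fun t => ?_) ?_ ?_ (.of_forall fun w t ht => ?_) hb
      (.of_forall fun w t _ => ?_)).2
    · convert! this using 1
      refine integral_congr_ae (.of_forall fun w => ?_)
      have h0 : D 0 w = 1 := by simp [hD]
      simp only [h0]; ring
    · exact (hDm t).aestronglyMeasurable.mul
        ((hG.1.sub aestronglyMeasurable_const).mul hψm.aestronglyMeasurable)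
    · have : Integrable (fun w => G w * ψ w) μ :=
        hGi.mul_bdd (c := C) hψm.aestronglyMeasurable (.of_forall fun w => hψ _)
      simpa [hD] using this
    · have hP' := hPm.aestronglyMeasurable (μ := μ)
      exact ((((hP'.sub aestronglyMeasurable_const).mul
        (hG.1.sub aestronglyMeasurable_const)).sub aestronglyMeasurable_const).mul
        (hDm 0).aestronglyMeasurable).mul hψm.aestronglyMeasurable
    · have ht1 : |t| ≤ 1 := by
        rw [Metric.mem_ball, dist_zero_right, Real.norm_eq_abs] at ht; exact ht.le
      have e0 : D t w ≤ Real.exp |P w| := by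
        refine Real.exp_le_exp.2 ?_
        have h1 : t * P w ≤ |P w| := by
          refine (le_abs_self _).trans ?_
          rw [abs_mul]
          exact mul_le_of_le_one_left (abs_nonneg _) ht1
        nlinarith [mul_nonneg (sq_nonneg t) (sq_nonneg ‖k‖)]
      have e1 : |P w| ≤ Real.exp |P w| := by linarith [Real.add_one_le_exp |P w|]
      have e2 : (1 : ℝ) ≤ Real.exp |P w| := Real.one_le_exp (abs_nonneg _)
      have e3 : Real.exp (2 * |P w|) = Real.exp |P w| * Real.exp |P w| := by
        rw [← Real.exp_add]; ring_nf
      have e4 : |P w - t * ‖k‖ ^ 2| ≤ (1 + ‖k‖ ^ 2) * Real.exp |P w| := by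
        refine (abs_sub _ _).trans ?_
        rw [abs_mul, abs_of_nonneg (sq_nonneg ‖k‖)]
        have : |t| * ‖k‖ ^ 2 ≤ ‖k‖ ^ 2 * Real.exp |P w| := by
          nlinarith [sq_nonneg ‖k‖, mul_le_mul ht1 e2 zero_le_one zero_le_one,
            mul_le_mul_of_nonneg_right ht1 (sq_nonneg ‖k‖),
            mul_le_mul_of_nonneg_left e2 (sq_nonneg ‖k‖)]
        linarith
      have e5 : |G w - t * c| ≤ |G w| + |c| := by
        refine (abs_sub _ _).trans ?_
        rw [abs_mul]
        gcongr
        exact mul_le_of_le_one_left (abs_nonneg _) ht1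
      have e6 : |(P w - t * ‖k‖ ^ 2) * (G w - t * c) - c|
          ≤ (1 + ‖k‖ ^ 2) * Real.exp |P w| * (|G w| + |c|) + |c| := by
        refine (abs_sub _ _).trans ?_
        rw [abs_mul]
        gcongr
      rw [norm_mul, norm_mul, Real.norm_eq_abs, Real.norm_eq_abs, Real.norm_eq_abs,
        abs_of_pos (Real.exp_pos _ : 0 < D t w)]
      calc |(P w - t * ‖k‖ ^ 2) * (G w - t * c) - c| * D t w * |ψ w|
          ≤ ((1 + ‖k‖ ^ 2) * Real.exp |P w| * (|G w| + |c|) + |c|) * Real.exp |P w| * C := by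
            gcongr
            exact hψ w
        _ ≤ ((1 + ‖k‖ ^ 2) * Real.exp |P w| * (|G w| + |c|) + |c| * Real.exp |P w|)
              * Real.exp |P w| * C := by
            gcongr
            exact le_mul_of_one_le_right (abs_nonneg _) e2
        _ = _ := by rw [e3]; ring
    · have hd : HasDerivAt (fun t => D t w) (D t w * (P w - t * ‖k‖ ^ 2)) t := by
        have h1 := ((hasDerivAt_id t).mul_const (P w)).sub
          (((hasDerivAt_pow 2 t).mul_const (‖k‖ ^ 2)).div_const 2)
        convert! h1.exp using 1
        simp [hD]; ring
      have hl : HasDerivAt (fun t => (G w - t * c) * ψ w) (-c * ψ w) t := by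
        have := (((hasDerivAt_id t).mul_const c).const_sub (G w)).mul_const (ψ w)
        simpa using this
      convert! hd.mul hl using 1
      ring
  have heq : (fun t : ℝ => ∫ w, G w * ψ (w + i (t • k)) ∂μ)
      = fun t : ℝ => ∫ w, D t w * ((G w - t * c) * ψ w) ∂μ := by
    funext t
    have h1 : ∫ w, G w * ψ (w + i (t • k)) ∂μ
        = ∫ w, (G (w + i (t • k)) - t * c) * ψ (w + i (t • k)) ∂μ := by
      refine integral_congr_ae ?_
      filter_upwards [hshift t] with w hw
      rw [hw]; ring
    rw [h1, integral_shift hW (t • k) fun w => (G w - t * c) * ψ w]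
    refine integral_congr_ae ?_
    have h2 : paleyWiener hW (t • k) =ᵐ[μ] t • P := by
      rw [map_smul]; exact Lp.coeFn_smul _ _
    filter_upwards [h2] with w hw
    rw [cmDensity, hw]
    simp [hD, norm_smul, mul_pow]
  rw [heq] at d1
  simpa using d1.unique d2

/-- The case where `ψ` is a derivative of the smooth cylindrical function `g ∘ Λ`. -/
theorem integral_mul_iteratedFDeriv_eq [IsProbabilityMeasure μ] (hW : IsAbstractWienerSpace i μ)
    (k : H) {G : W → ℝ} {c : ℝ} (hG : MemLp G 2 μ)
    (hshift : ∀ t : ℝ, ∀ᵐ w ∂μ, G (w + i (t • k)) = G w + t * c)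
    {n : ℕ} (Λ : W →L[ℝ] Fin n → ℝ) {g : (Fin n → ℝ) → ℝ} (hg : ContDiff ℝ ∞ g)
    (hb : ∀ k : ℕ, ∃ C : ℝ, ∀ x, ‖iteratedFDeriv ℝ k g x‖ ≤ C) (m : ℕ)
    (u : Fin m → Fin n → ℝ) :
    ∫ w, G w * iteratedFDeriv ℝ (m + 1) g (Λ w) (Fin.cons (Λ (i k)) u) ∂μ
      = ∫ w, (G w * paleyWiener hW k w - c) * iteratedFDeriv ℝ m g (Λ w) u ∂μ := by
  have hbd : ∀ (r : ℕ) (v : Fin r → Fin n → ℝ), ∃ C : ℝ, ∀ x, |iteratedFDeriv ℝ r g x v| ≤ C := by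
    intro r v
    obtain ⟨C, hC⟩ := hb r
    exact ⟨C * ∏ j, ‖v j‖, fun x => (ContinuousMultilinearMap.le_opNorm _ _).trans
      (mul_le_mul_of_nonneg_right (hC x) (Finset.prod_nonneg fun _ _ => norm_nonneg _))⟩
  have hmeas : ∀ (r : ℕ) (v : Fin r → Fin n → ℝ),
      Measurable fun w => iteratedFDeriv ℝ r g (Λ w) v := by
    intro r v
    have h1 : Continuous (iteratedFDeriv ℝ r g) :=
      hg.continuous_iteratedFDeriv (by exact_mod_cast (WithTop.coe_lt_top r).le)
    exact ((ContinuousMultilinearMap.apply ℝ (fun _ : Fin r => Fin n → ℝ) ℝ v).continuous.comp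
      (h1.comp Λ.continuous)).measurable
  obtain ⟨C, hC⟩ := hbd m u
  obtain ⟨C', hC'⟩ := hbd (m + 1) (Fin.cons (Λ (i k)) u)
  refine integral_mul_deriv_eq hW k (C := max C C') hG hshift (hmeas _ _) (hmeas _ _)
    (fun w => (hC _).trans (le_max_left _ _)) (fun w => (hC' _).trans (le_max_right _ _)) ?_
  intro w t
  simpa using hasDerivAt_iteratedFDeriv_line hg m (Λ w) (Λ (i k)) u t

/-- `δh` is the divergence of `h`. -/
theorem isDivergence_paleyWiener [IsProbabilityMeasure μ] (hW : IsAbstractWienerSpace i μ) (h : H) :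
    IsDivergence i μ ![h] (paleyWiener hW h) := by
  rintro φ ⟨n, ℓ, g, hg, hb, hφ⟩
  obtain rfl : φ = fun w => g (ContinuousLinearMap.pi ℓ w) := funext hφ
  simp_rw [grad_comp_eq i (ContinuousLinearMap.pi ℓ) hg]
  have := integral_mul_iteratedFDeriv_eq hW h (G := fun _ => 1) (c := 0) (memLp_const 1) (by simp)
    (ContinuousLinearMap.pi ℓ) hg hb 0 ![]
  simp only [one_mul, sub_zero, iteratedFDeriv_zero_apply] at this
  rw [← this]
  refine integral_congr_ae (.of_forall fun w => ?_)
  refine congrArg _ (funext fun j => ?_)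
  fin_cases j
  rfl

theorem memLp_paleyWiener_mul [IsProbabilityMeasure μ] (hW : IsAbstractWienerSpace i μ) (h k : H) :
    MemLp (fun w => paleyWiener hW h w * paleyWiener hW k w) 2 μ := by
  have : ENNReal.HolderTriple 4 4 2 := ⟨by
    rw [← two_mul, show (4 : ℝ≥0∞) = 2 * 2 by norm_num, ENNReal.mul_inv (by simp) (by simp),
      ← mul_assoc, ENNReal.mul_inv_cancel (by simp) (by simp), one_mul]⟩
  exact (memLp_paleyWiener hW k (p := 4) (by simp)).mul
    (memLp_paleyWiener hW h (p := 4) (by simp))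

/-- `δ²(h ⊗ k) = δh δk - (h, k)`, as an element of `L²(μ)`. -/
noncomputable def divTwo [IsProbabilityMeasure μ] (hW : IsAbstractWienerSpace i μ) (h k : H) :
    Lp ℝ 2 μ :=
  ((memLp_paleyWiener_mul hW h k).sub (memLp_const ⟪h, k⟫_ℝ)).toLp _

theorem coeFn_divTwo [IsProbabilityMeasure μ] (hW : IsAbstractWienerSpace i μ) (h k : H) :
    divTwo hW h k =ᵐ[μ] fun w => paleyWiener hW h w * paleyWiener hW k w - ⟪h, k⟫_ℝ :=
  MemLp.coeFn_toLp ((memLp_paleyWiener_mul hW h k).sub (memLp_const ⟪h, k⟫_ℝ))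

theorem isDivergence_divTwo [IsProbabilityMeasure μ] (hW : IsAbstractWienerSpace i μ) (h k : H) :
    IsDivergence i μ ![h, k] (divTwo hW h k) := by
  rintro φ ⟨n, ℓ, g, hg, hb, hφ⟩
  obtain rfl : φ = fun w => g (ContinuousLinearMap.pi ℓ w) := funext hφ
  simp_rw [grad_comp_eq i (ContinuousLinearMap.pi ℓ) hg]
  have h1 := integral_mul_iteratedFDeriv_eq hW h (G := fun _ => 1) (c := 0) (memLp_const 1)
    (by simp) (ContinuousLinearMap.pi ℓ) hg hb 1 ![ContinuousLinearMap.pi ℓ (i k)]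
  have hs : ∀ t : ℝ, ∀ᵐ w ∂μ, paleyWiener hW h (w + i (t • k))
      = paleyWiener hW h w + t * ⟪h, k⟫_ℝ := fun t => by
    simpa [inner_smul_right] using paleyWiener_shift hW h (t • k)
  have h2 := integral_mul_iteratedFDeriv_eq hW k (Lp.memLp (paleyWiener hW h)) hs
    (ContinuousLinearMap.pi ℓ) hg hb 0 ![]
  simp only [one_mul, sub_zero] at h1
  calc ∫ w, divTwo hW h k w * g (ContinuousLinearMap.pi ℓ w) ∂μ
      = ∫ w, (paleyWiener hW h w * paleyWiener hW k w - ⟪h, k⟫_ℝ)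
          * iteratedFDeriv ℝ 0 g (ContinuousLinearMap.pi ℓ w) ![] ∂μ := by
        refine integral_congr_ae ?_
        filter_upwards [coeFn_divTwo hW h k] with w hw
        rw [hw, iteratedFDeriv_zero_apply]
    _ = ∫ w, paleyWiener hW h w * iteratedFDeriv ℝ 1 g (ContinuousLinearMap.pi ℓ w)
          ![ContinuousLinearMap.pi ℓ (i k)] ∂μ := by
        rw [← h2]
        refine integral_congr_ae (.of_forall fun w => ?_)
        refine congrArg (fun u => _ * iteratedFDeriv ℝ 1 g _ u) (funext fun j => ?_)
        fin_cases j
        rfl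
    _ = _ := by
        rw [← h1]
        refine integral_congr_ae (.of_forall fun w => ?_)
        refine congrArg _ (funext fun j => ?_)
        fin_cases j <;> rfl

/-! ### Mixed moments of the variables `δh` -/

theorem integrable_paleyWiener_pow [IsProbabilityMeasure μ] (hW : IsAbstractWienerSpace i μ)
    (h : H) (n : ℕ) : Integrable (fun w => paleyWiener hW h w ^ n) μ := by
  have : integrableExpSet (paleyWiener hW h) μ = Set.univ :=
    Set.eq_univ_of_forall fun t => integrable_exp_paleyWiener hW h t
  exact integrable_pow_of_mem_interior_integrableExpSet (by simp [this]) n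

theorem integral_paleyWiener_pow [IsProbabilityMeasure μ] (hW : IsAbstractWienerSpace i μ)
    (h : H) (n : ℕ) :
    ∫ w, paleyWiener hW h w ^ n ∂μ = ∫ x, x ^ n ∂gaussianReal 0 (‖h‖₊ ^ 2) := by
  rw [← map_paleyWiener hW h, integral_map (measurable_paleyWiener hW h).aemeasurable (by fun_prop)]

theorem integral_paleyWiener [IsProbabilityMeasure μ] (hW : IsAbstractWienerSpace i μ) (h : H) :
    ∫ w, paleyWiener hW h w ∂μ = 0 := by
  simpa [integral_id_gaussianReal] using integral_paleyWiener_pow hW h 1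

theorem integrable_sub_and_integral_sub_eq {f g : W → ℝ} {x y : ℝ}
    (hf : Integrable f μ ∧ ∫ w, f w ∂μ = x) (hg : Integrable g μ ∧ ∫ w, g w ∂μ = y) :
    Integrable (fun w => f w - g w) μ ∧ ∫ w, f w - g w ∂μ = x - y :=
  ⟨hf.1.sub hg.1, by rw [integral_sub hf.1 hg.1, hf.2, hg.2]⟩

theorem paleyWiener_linearCombination_ae (hW : IsAbstractWienerSpace i μ) (a b c d : H)
    (r s t : ℝ) : ∀ᵐ w ∂μ, paleyWiener hW (a + r • b + s • c + t • d) w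
      = paleyWiener hW a w + r * paleyWiener hW b w + s * paleyWiener hW c w
        + t * paleyWiener hW d w := by
  simp only [map_add, map_smul]
  filter_upwards [Lp.coeFn_add (paleyWiener hW a + r • paleyWiener hW b + s • paleyWiener hW c)
      (t • paleyWiener hW d),
    Lp.coeFn_add (paleyWiener hW a + r • paleyWiener hW b) (s • paleyWiener hW c),
    Lp.coeFn_add (paleyWiener hW a) (r • paleyWiener hW b),
    Lp.coeFn_smul r (paleyWiener hW b), Lp.coeFn_smul s (paleyWiener hW c),
    Lp.coeFn_smul t (paleyWiener hW d)] with w h1 h2 h3 h4 h5 h6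
  rw [h1, Pi.add_apply, h2, Pi.add_apply, h3, Pi.add_apply, h4, h5, h6]
  simp

/-- Isserlis' formula for four factors, by polarization of `E[(δh)⁴] = 3 |h|⁴`. -/
theorem integral_paleyWiener_mul_four [IsProbabilityMeasure μ] (hW : IsAbstractWienerSpace i μ)
    (a b c d : H) :
    Integrable (fun w => paleyWiener hW a w * paleyWiener hW b w
      * (paleyWiener hW c w * paleyWiener hW d w)) μ ∧
    ∫ w, paleyWiener hW a w * paleyWiener hW b w
      * (paleyWiener hW c w * paleyWiener hW d w) ∂μ
      = ⟪a, b⟫_ℝ * ⟪c, d⟫_ℝ + ⟪a, c⟫_ℝ * ⟪b, d⟫_ℝ + ⟪a, d⟫_ℝ * ⟪b, c⟫_ℝ := by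
  set A := paleyWiener hW a
  set B := paleyWiener hW b
  set C := paleyWiener hW c
  set D := paleyWiener hW d
  have key : ∀ r s t : ℝ, Integrable (fun w => (A w + r * B w + s * C w + t * D w) ^ 4) μ ∧
      ∫ w, (A w + r * B w + s * C w + t * D w) ^ 4 ∂μ
        = 3 * (‖a‖ ^ 2 + r ^ 2 * ‖b‖ ^ 2 + s ^ 2 * ‖c‖ ^ 2 + t ^ 2 * ‖d‖ ^ 2
          + 2 * (r * ⟪a, b⟫_ℝ + s * ⟪a, c⟫_ℝ + t * ⟪a, d⟫_ℝ
            + r * s * ⟪b, c⟫_ℝ + r * t * ⟪b, d⟫_ℝ + s * t * ⟪c, d⟫_ℝ)) ^ 2 := by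
    intro r s t
    have h1 : (fun w => paleyWiener hW (a + r • b + s • c + t • d) w ^ 4)
        =ᵐ[μ] fun w => (A w + r * B w + s * C w + t * D w) ^ 4 := by
      filter_upwards [paleyWiener_linearCombination_ae hW a b c d r s t] with w hw
      rw [hw]
    refine ⟨(integrable_paleyWiener_pow hW _ 4).congr h1, ?_⟩
    rw [← integral_congr_ae h1, integral_paleyWiener_pow, (integral_pow_gaussianReal _).2]
    congr 2
    push_cast
    rw [norm_add_sq_real, norm_add_sq_real, norm_add_sq_real]
    simp only [inner_add_left, real_inner_smul_left, real_inner_smul_right, norm_smul, mul_pow,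
      Real.norm_eq_abs, sq_abs]
    ring
  have k1 := fun r s => integrable_sub_and_integral_sub_eq (key r s 1) (key r s (-1))
  have k2 := fun r => integrable_sub_and_integral_sub_eq (k1 r 1) (k1 r (-1))
  have k3 := integrable_sub_and_integral_sub_eq (k2 1) (k2 (-1))
  -- `192 a b c d` is the sum of `rst (a + r b + s c + t d)⁴` over the signs `r`, `s`, `t`.
  have k4 : Integrable (fun w => 192 * (A w * B w * (C w * D w))) μ ∧
      ∫ w, 192 * (A w * B w * (C w * D w)) ∂μ = 192 *
        (⟪a, b⟫_ℝ * ⟪c, d⟫_ℝ + ⟪a, c⟫_ℝ * ⟪b, d⟫_ℝ + ⟪a, d⟫_ℝ * ⟪b, c⟫_ℝ) := by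
    refine ⟨k3.1.congr (.of_forall fun w => ?_),
      (integral_congr_ae (.of_forall fun w => ?_)).trans (k3.2.trans ?_)⟩ <;>
    · beta_reduce
      ring
  refine ⟨by simpa using k4.1.const_mul (192⁻¹ : ℝ), ?_⟩
  have := k4.2
  rw [integral_const_mul] at this
  linarith

theorem integral_paleyWiener_mul_three [IsProbabilityMeasure μ] (hW : IsAbstractWienerSpace i μ)
    (a b c : H) :
    Integrable (fun w => paleyWiener hW a w * paleyWiener hW b w * paleyWiener hW c w) μ ∧
    ∫ w, paleyWiener hW a w * paleyWiener hW b w * paleyWiener hW c w ∂μ = 0 := by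
  set A := paleyWiener hW a
  set B := paleyWiener hW b
  set C := paleyWiener hW c
  have key : ∀ r s : ℝ, Integrable (fun w => (A w + r * B w + s * C w) ^ 3) μ ∧
      ∫ w, (A w + r * B w + s * C w) ^ 3 ∂μ = 0 := by
    intro r s
    have h1 : (fun w => paleyWiener hW (a + r • b + s • c + (0 : ℝ) • c) w ^ 3)
        =ᵐ[μ] fun w => (A w + r * B w + s * C w) ^ 3 := by
      filter_upwards [paleyWiener_linearCombination_ae hW a b c c r s 0] with w hw
      rw [hw]; ring
    refine ⟨(integrable_paleyWiener_pow hW _ 3).congr h1, ?_⟩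
    rw [← integral_congr_ae h1, integral_paleyWiener_pow, (integral_pow_gaussianReal _).1]
  have k1 := fun r => integrable_sub_and_integral_sub_eq (key r 1) (key r (-1))
  have k2 := integrable_sub_and_integral_sub_eq (k1 1) (k1 (-1))
  -- `24 a b c` is the sum of `rs (a + r b + s c)³` over the signs `r`, `s`.
  have k4 : Integrable (fun w => 24 * (A w * B w * C w)) μ ∧
      ∫ w, 24 * (A w * B w * C w) ∂μ = 0 := by
    refine ⟨k2.1.congr (.of_forall fun w => ?_),
      (integral_congr_ae (.of_forall fun w => ?_)).trans (k2.2.trans ?_)⟩ <;>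
    · beta_reduce
      ring
  refine ⟨by simpa using k4.1.const_mul (24⁻¹ : ℝ), ?_⟩
  have := k4.2
  rw [integral_const_mul] at this
  linarith

theorem integrable_paleyWiener_mul (hW : IsAbstractWienerSpace i μ) (a b : H) :
    Integrable (fun w => paleyWiener hW a w * paleyWiener hW b w) μ :=
  integrable_mul_Lp _ _

/-- `E[δ²(h ⊗ k) δa δb] = (h, a)(k, b) + (h, b)(k, a)`. -/
theorem integral_divTwo_mul_paleyWiener_mul [IsProbabilityMeasure μ]
    (hW : IsAbstractWienerSpace i μ) (h k a b : H) :
    ∫ w, divTwo hW h k w * (paleyWiener hW a w * paleyWiener hW b w) ∂μ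
      = ⟪h, a⟫_ℝ * ⟪k, b⟫_ℝ + ⟪h, b⟫_ℝ * ⟪k, a⟫_ℝ := by
  have h4 := integral_paleyWiener_mul_four hW h k a b
  have h1 : (fun w => divTwo hW h k w * (paleyWiener hW a w * paleyWiener hW b w))
      =ᵐ[μ] fun w => paleyWiener hW h w * paleyWiener hW k w
        * (paleyWiener hW a w * paleyWiener hW b w)
        - ⟪h, k⟫_ℝ * (paleyWiener hW a w * paleyWiener hW b w) := by
    filter_upwards [coeFn_divTwo hW h k] with w hw
    rw [hw]; ring
  rw [integral_congr_ae h1, integral_sub h4.1 ((integrable_paleyWiener_mul hW a b).const_mul _),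
    h4.2, integral_const_mul, integral_paleyWiener_mul]
  ring

theorem integral_divTwo [IsProbabilityMeasure μ] (hW : IsAbstractWienerSpace i μ) (h k : H) :
    ∫ w, divTwo hW h k w ∂μ = 0 := by
  rw [integral_congr_ae (coeFn_divTwo hW h k),
    integral_sub (integrable_paleyWiener_mul hW h k) (integrable_const _),
    integral_paleyWiener_mul]
  simp

theorem integral_divTwo_mul_paleyWiener [IsProbabilityMeasure μ] (hW : IsAbstractWienerSpace i μ)
    (h k a : H) : ∫ w, divTwo hW h k w * paleyWiener hW a w ∂μ = 0 := by
  have h3 := integral_paleyWiener_mul_three hW h k a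
  have h1 : (fun w => divTwo hW h k w * paleyWiener hW a w)
      =ᵐ[μ] fun w => paleyWiener hW h w * paleyWiener hW k w * paleyWiener hW a w
        - ⟪h, k⟫_ℝ * paleyWiener hW a w := by
    filter_upwards [coeFn_divTwo hW h k] with w hw
    rw [hw]; ring
  have hi : Integrable (paleyWiener hW a) μ := (Lp.memLp _).integrable (by norm_num)
  rw [integral_congr_ae h1, integral_sub h3.1 (hi.const_mul _), h3.2, integral_const_mul,
    integral_paleyWiener]
  simp

theorem inner_divTwo [IsProbabilityMeasure μ] (hW : IsAbstractWienerSpace i μ) (h k a b : H) :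
    ⟪divTwo hW h k, divTwo hW a b⟫_ℝ = ⟪h, a⟫_ℝ * ⟪k, b⟫_ℝ + ⟪h, b⟫_ℝ * ⟪k, a⟫_ℝ := by
  have hi : Integrable (divTwo hW h k) μ := (Lp.memLp _).integrable (by norm_num)
  have h1 : (fun w => divTwo hW h k w * divTwo hW a b w)
      =ᵐ[μ] fun w => divTwo hW h k w * (paleyWiener hW a w * paleyWiener hW b w)
        - divTwo hW h k w * ⟪a, b⟫_ℝ := by
    filter_upwards [coeFn_divTwo hW a b] with w hw
    rw [hw]; ring
  have hi' : Integrable (fun w => divTwo hW h k w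
      * (paleyWiener hW a w * paleyWiener hW b w)) μ :=
    (Lp.memLp (divTwo hW h k)).integrable_mul (memLp_paleyWiener_mul hW a b)
  rw [real_inner_Lp_eq_integral, integral_congr_ae h1, integral_sub hi' (hi.mul_const _), integral_mul_const, integral_divTwo, integral_divTwo_mul_paleyWiener_mul]
  ring

theorem norm_divTwo_le [IsProbabilityMeasure μ] (hW : IsAbstractWienerSpace i μ) (h k : H) :
    ‖divTwo hW h k‖ ≤ 2 * ‖h‖ * ‖k‖ := by
  refine (pow_le_pow_iff_left₀ (norm_nonneg _) (by positivity) two_ne_zero).1 ?_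
  rw [← real_inner_self_eq_norm_sq, inner_divTwo, real_inner_self_eq_norm_sq,
    real_inner_self_eq_norm_sq, real_inner_comm h k]
  have := abs_real_inner_le_norm h k
  have h2 : ⟪h, k⟫_ℝ * ⟪h, k⟫_ℝ ≤ (‖h‖ * ‖k‖) * (‖h‖ * ‖k‖) := by
    rw [← abs_mul_abs_self ⟪h, k⟫_ℝ]; gcongr
  nlinarith [mul_nonneg (sq_nonneg ‖h‖) (sq_nonneg ‖k‖)]

theorem divTwo_add_left [IsProbabilityMeasure μ] (hW : IsAbstractWienerSpace i μ) (h h' k : H) :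
    divTwo hW (h + h') k = divTwo hW h k + divTwo hW h' k := by
  refine Lp.ext ?_
  have : paleyWiener hW (h + h') =ᵐ[μ] paleyWiener hW h + paleyWiener hW h' := by
    rw [map_add]; exact Lp.coeFn_add _ _
  filter_upwards [coeFn_divTwo hW (h + h') k, coeFn_divTwo hW h k, coeFn_divTwo hW h' k, this,
    Lp.coeFn_add (divTwo hW h k) (divTwo hW h' k)] with w h1 h2 h3 h4 h5
  rw [h5, Pi.add_apply, h1, h2, h3, h4, Pi.add_apply, inner_add_left]
  ring

theorem divTwo_smul_left [IsProbabilityMeasure μ] (hW : IsAbstractWienerSpace i μ) (c : ℝ)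
    (h k : H) : divTwo hW (c • h) k = c • divTwo hW h k := by
  refine Lp.ext ?_
  have : paleyWiener hW (c • h) =ᵐ[μ] c • paleyWiener hW h := by
    rw [map_smul]; exact Lp.coeFn_smul _ _
  filter_upwards [coeFn_divTwo hW (c • h) k, coeFn_divTwo hW h k, this,
    Lp.coeFn_smul c (divTwo hW h k)] with w h1 h2 h3 h4
  rw [h4, Pi.smul_apply, h1, h2, h3, Pi.smul_apply, real_inner_smul_left, smul_eq_mul, smul_eq_mul]
  ring

theorem divTwo_comm [IsProbabilityMeasure μ] (hW : IsAbstractWienerSpace i μ) (h k : H) :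
    divTwo hW h k = divTwo hW k h := by
  refine Lp.ext ?_
  filter_upwards [coeFn_divTwo hW h k, coeFn_divTwo hW k h] with w h1 h2
  rw [h1, h2, real_inner_comm, mul_comm]

/-- `δ²` as a continuous bilinear map. -/
noncomputable def divTwoL [IsProbabilityMeasure μ] (hW : IsAbstractWienerSpace i μ) :
    H →L[ℝ] H →L[ℝ] Lp ℝ 2 μ :=
  LinearMap.mkContinuous₂
    (LinearMap.mk₂ ℝ (divTwo hW) (divTwo_add_left hW) (divTwo_smul_left hW)
      (fun h k k' => by rw [divTwo_comm, divTwo_add_left, divTwo_comm, divTwo_comm hW k'])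
      (fun c h k => by rw [divTwo_comm, divTwo_smul_left, divTwo_comm]))
    2 (norm_divTwo_le hW)

@[simp] theorem divTwoL_apply [IsProbabilityMeasure μ] (hW : IsAbstractWienerSpace i μ) (h k : H) :
    divTwoL hW h k = divTwo hW h k := rfl

/-! ### Equivalence of the `L^p` norms on polynomials of degree at most two -/

theorem integral_cexp_dual [IsProbabilityMeasure μ] (hW : IsAbstractWienerSpace i μ)
    (ℓ : W →L[ℝ] ℝ) :
    ∫ w, Complex.exp (ℓ w * Complex.I) ∂μ = Complex.exp (-(‖adj i ℓ‖ ^ 2 / 2 : ℝ)) := by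
  have h1 := charFun_gaussianReal (μ := 0) (v := ‖adj i ℓ‖₊ ^ 2) 1
  rw [← hW.map_dual_eq, charFun_apply_real,
    integral_map ℓ.continuous.measurable.aemeasurable (by fun_prop)] at h1
  simpa [neg_div] using h1

theorem integral_cexp_dual_prod [IsProbabilityMeasure μ] (hW : IsAbstractWienerSpace i μ)
    (ℓ ℓ' : W →L[ℝ] ℝ) :
    ∫ z : W × W, Complex.exp ((ℓ z.1 + ℓ' z.2 : ℝ) * Complex.I) ∂μ.prod μ
      = Complex.exp (-((‖adj i ℓ‖ ^ 2 + ‖adj i ℓ'‖ ^ 2) / 2 : ℝ)) := by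
  have h1 := integral_prod_mul (μ := μ) (ν := μ) (fun w => Complex.exp (ℓ w * Complex.I))
    (fun w => Complex.exp (ℓ' w * Complex.I))
  simp_rw [← Complex.exp_add, integral_cexp_dual hW] at h1
  convert! h1 using 1
  · refine integral_congr_ae (.of_forall fun z => ?_)
    simp only
    congr 1
    push_cast; ring
  · rw [← Complex.exp_add]
    congr 1
    push_cast; ring

/-- The rotation of `W × W` by the angle `π / 4`. -/
noncomputable def rotation (z : W × W) : W × W :=
  ((√2)⁻¹ • (z.1 - z.2), (√2)⁻¹ • (z.1 + z.2))

theorem measurable_rotation : Measurable (rotation : W × W → W × W) := by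
  have : Continuous (rotation : W × W → W × W) := by unfold rotation; fun_prop
  exact this.measurable

/-- The measure `μ ⊗ μ` is invariant under rotations: if `X` and `Y` are independent with law `μ`,
then so are `(X - Y)/√2` and `(X + Y)/√2`. -/
theorem measurePreserving_rotation [IsProbabilityMeasure μ] (hW : IsAbstractWienerSpace i μ) :
    MeasurePreserving rotation (μ.prod μ) (μ.prod μ) := by
  refine ⟨measurable_rotation, ?_⟩
  have : IsProbabilityMeasure ((μ.prod μ).map rotation) :=
    Measure.isProbabilityMeasure_map measurable_rotation.aemeasurable
  refine ext_of_integral_cexp_eq (D := (W →L[ℝ] ℝ) × (W →L[ℝ] ℝ))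
    (LinearMap.mk₂ ℝ (fun (z : W × W) (d : (W →L[ℝ] ℝ) × (W →L[ℝ] ℝ)) => d.1 z.1 + d.2 z.2)
      (fun _ _ _ => by simp; ring) (fun _ _ _ => by simp; ring)
      (fun _ _ _ => by simp; ring) (fun _ _ _ => by simp; ring)) ?_ ?_ ?_
  · intro d
    simp only [LinearMap.mk₂_apply]
    fun_prop
  · rintro ⟨x, y⟩ hxy
    by_cases hx : x = 0
    · have hy : y ≠ 0 := fun hy => hxy (by simp [hx, hy])
      obtain ⟨ℓ, hℓ⟩ := SeparatingDual.exists_ne_zero (R := ℝ) hy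
      exact ⟨(0, ℓ), by simpa using hℓ⟩
    · obtain ⟨ℓ, hℓ⟩ := SeparatingDual.exists_ne_zero (R := ℝ) hx
      exact ⟨(ℓ, 0), by simpa using hℓ⟩
  · rintro ⟨ℓ, ℓ'⟩
    simp only [LinearMap.mk₂_apply]
    rw [integral_cexp_dual_prod hW, integral_map measurable_rotation.aemeasurable]
    · have h2 : ∀ z : W × W, ℓ (rotation z).1 + ℓ' (rotation z).2
          = ((√2)⁻¹ • (ℓ + ℓ')) z.1 + ((√2)⁻¹ • (ℓ' - ℓ)) z.2 := by
        intro z; simp [rotation]; ring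
      simp_rw [h2]
      rw [integral_cexp_dual_prod hW]
      simp only [map_smul, map_add, map_sub, norm_smul, mul_pow, norm_inv, inv_pow,
        Real.norm_eq_abs, sq_abs, norm_add_sq_real, norm_sub_sq_real, Nat.ofNat_nonneg,
        Real.sq_sqrt, real_inner_comm (adj i ℓ) (adj i ℓ')]
      congr 3
      ring
    · have : Continuous fun z : W × W => Complex.exp ((ℓ z.1 + ℓ' z.2 : ℝ) * Complex.I) := by
        fun_prop
      exact this.measurable.aestronglyMeasurable

/-- The difference of `P` at two independent copies, expressed through the rotated variables, is
linear in the first and affine in the second. Polynomials of degree at most two have this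
property, which turns estimates on them into estimates on sections that are Gaussian. -/
def IsDecoupled (P : W → ℝ) : Prop :=
  Measurable P ∧ ∃ G : W → W → ℝ, Measurable (Function.uncurry G) ∧
    (∀ y, ∃ ℓ : W →L[ℝ] ℝ, ∀ x, G x y = ℓ x) ∧
    (∀ x, ∃ (ℓ : W →L[ℝ] ℝ) (c : ℝ), ∀ y, G x y = ℓ y + c) ∧
    ∀ x y, P x - P y = G ((√2)⁻¹ • (x - y)) ((√2)⁻¹ • (x + y))

theorem IsDecoupled.add {P Q : W → ℝ} (hP : IsDecoupled P) (hQ : IsDecoupled Q) :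
    IsDecoupled fun w => P w + Q w := by
  obtain ⟨hPm, G, hG, h1, h2, h3⟩ := hP
  obtain ⟨hQm, G', hG', h1', h2', h3'⟩ := hQ
  refine ⟨hPm.add hQm, fun x y => G x y + G' x y, hG.add hG', fun y => ?_, fun x => ?_,
    fun x y => ?_⟩
  · obtain ⟨ℓ, hℓ⟩ := h1 y
    obtain ⟨ℓ', hℓ'⟩ := h1' y
    exact ⟨ℓ + ℓ', fun x => by simp [hℓ, hℓ']⟩
  · obtain ⟨ℓ, c, hℓ⟩ := h2 x
    obtain ⟨ℓ', c', hℓ'⟩ := h2' x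
    exact ⟨ℓ + ℓ', c + c', fun x => by simp [hℓ, hℓ']; ring⟩
  · beta_reduce
    rw [← h3, ← h3']; ring

theorem IsDecoupled.const_mul {P : W → ℝ} (hP : IsDecoupled P) (a : ℝ) :
    IsDecoupled fun w => a * P w := by
  obtain ⟨hPm, G, hG, h1, h2, h3⟩ := hP
  refine ⟨hPm.const_mul a, fun x y => a * G x y, hG.const_mul a, fun y => ?_, fun x => ?_,
    fun x y => ?_⟩
  · obtain ⟨ℓ, hℓ⟩ := h1 y
    exact ⟨a • ℓ, fun x => by simp [hℓ]⟩
  · obtain ⟨ℓ, c, hℓ⟩ := h2 x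
    exact ⟨a • ℓ, a * c, fun x => by simp [hℓ]; ring⟩
  · beta_reduce
    rw [← h3]; ring

theorem isDecoupled_const (c : ℝ) : IsDecoupled fun _ : W => c :=
  ⟨measurable_const, fun _ _ => 0, measurable_const, fun _ => ⟨0, by simp⟩,
    fun _ => ⟨0, 0, by simp⟩, by simp⟩

theorem isDecoupled_dual (ℓ : W →L[ℝ] ℝ) : IsDecoupled ℓ := by
  have hℓ := ℓ.continuous.measurable
  refine ⟨hℓ, fun x _ => √2 * ℓ x, (hℓ.comp measurable_fst).const_mul _,
    fun _ => ⟨√2 • ℓ, by simp⟩, fun x => ⟨0, √2 * ℓ x, by simp⟩, fun x y => ?_⟩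
  simp

theorem isDecoupled_dual_mul (ℓ ℓ' : W →L[ℝ] ℝ) : IsDecoupled fun w => ℓ w * ℓ' w := by
  have hℓ := ℓ.continuous.measurable
  have hℓ' := ℓ'.continuous.measurable
  refine ⟨hℓ.mul hℓ', fun x y => ℓ x * ℓ' y + ℓ y * ℓ' x,
    ((hℓ.comp measurable_fst).mul (hℓ'.comp measurable_snd)).add
      ((hℓ.comp measurable_snd).mul (hℓ'.comp measurable_fst)),
    fun y => ⟨ℓ' y • ℓ + ℓ y • ℓ', fun x => by simp; ring⟩,
    fun x => ⟨ℓ x • ℓ' + ℓ' x • ℓ, 0, fun y => by simp; ring⟩, fun x y => ?_⟩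
  have h2 : (√2)⁻¹ * (√2)⁻¹ = (1 / 2 : ℝ) := by
    rw [← mul_inv, Real.mul_self_sqrt (by norm_num)]; norm_num
  simp only [map_smul, map_sub, map_add, smul_eq_mul]
  linear_combination (-2 * (ℓ x * ℓ' x - ℓ y * ℓ' y)) * h2

theorem isDecoupled_prod {k : ℕ} (hk : k ≤ 2) (ℓ : Fin k → W →L[ℝ] ℝ) :
    IsDecoupled fun w => ∏ j, ℓ j w := by
  interval_cases k
  · simpa using isDecoupled_const (W := W) 1
  · simpa using isDecoupled_dual (ℓ 0)
  · simpa [Fin.prod_univ_two] using isDecoupled_dual_mul (ℓ 0) (ℓ 1)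

theorem enorm_integral_le_eLpNorm_two [IsProbabilityMeasure μ] {f : W → ℝ}
    (hf : AEStronglyMeasurable f μ) : ‖∫ w, f w ∂μ‖ₑ ≤ eLpNorm f 2 μ := by
  refine (enorm_integral_le_lintegral_enorm _).trans ?_
  rw [← eLpNorm_one_eq_lintegral_enorm]
  exact eLpNorm_le_eLpNorm_of_exponent_le (by norm_num) hf

theorem integral_dual (hW : IsAbstractWienerSpace i μ) (ℓ : W →L[ℝ] ℝ) : ∫ w, ℓ w ∂μ = 0 := by
  have h := integral_map (μ := μ) ℓ.continuous.measurable.aemeasurable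
    (f := fun x : ℝ => x) (by fun_prop)
  rw [← h, hW.map_dual_eq, integral_id_gaussianReal]

/-- For affine functionals of a Gaussian variable the `L^p` norm is bounded by the `L²` norm. -/
theorem exists_eLpNorm_affine_le [IsProbabilityMeasure μ] (hW : IsAbstractWienerSpace i μ)
    {p : ℝ≥0} (hp : 1 ≤ p) : ∃ K : ℝ≥0, ∀ (ℓ : W →L[ℝ] ℝ) (c : ℝ),
      eLpNorm (fun w => ℓ w + c) p μ ≤ K * eLpNorm (fun w => ℓ w + c) 2 μ := by
  set N := eLpNorm id p (gaussianReal 0 1) with hN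
  have hNtop : N ≠ ⊤ := (memLp_id_gaussianReal (μ := 0) (v := 1) p).eLpNorm_ne_top
  refine ⟨2 * N.toNNReal + 1, fun ℓ c => ?_⟩
  have hℓm := ℓ.continuous.measurable
  set A := eLpNorm (fun w => ℓ w + c) 2 μ with hA
  have hc : ‖c‖ₑ ≤ A := by
    have := enorm_integral_le_eLpNorm_two (μ := μ) (f := fun w => ℓ w + c)
      (hℓm.add_const c).aestronglyMeasurable
    rwa [integral_add ((hW.memLp_dual ℓ (p := 1) (by simp)).integrable le_rfl)
      (integrable_const _), integral_dual hW, integral_const, zero_add, probReal_univ,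
      one_smul] at this
  have hcp : ∀ q : ℝ≥0∞, eLpNorm (fun _ : W => c) q μ ≤ ‖c‖ₑ := by
    intro q
    rcases eq_or_ne q 0 with rfl | hq
    · simp
    · simp [eLpNorm_const c hq (IsProbabilityMeasure.ne_zero μ)]
  have hℓ2 : ‖adj i ℓ‖ₑ ≤ 2 * A := by
    have e1 : ‖adj i ℓ‖ₑ = eLpNorm ℓ 2 μ := by
      rw [← eLpNorm_congr_ae (coeFn_dualToLp hW ℓ), ← Lp.enorm_def, ← ofReal_norm,
        ← ofReal_norm, norm_dualToLp]
    have e2 : (ℓ : W → ℝ) = (fun w => ℓ w + c) - fun _ => c := by ext w; simp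
    rw [e1, e2, two_mul]
    refine (eLpNorm_sub_le (hℓm.add_const c).aestronglyMeasurable aestronglyMeasurable_const
      (by norm_num)).trans ?_
    gcongr
    exact (hcp 2).trans hc
  calc eLpNorm (fun w => ℓ w + c) p μ
      ≤ eLpNorm ℓ p μ + eLpNorm (fun _ : W => c) p μ :=
        eLpNorm_add_le hℓm.aestronglyMeasurable aestronglyMeasurable_const (by exact_mod_cast hp)
    _ ≤ ‖adj i ℓ‖ₑ * N + A := by
        refine add_le_add (le_of_eq ?_) ((hcp p).trans hc)
        rw [eLpNorm_of_map_eq_gaussianReal hℓm.aemeasurable (hW.map_dual_eq ℓ), enorm_eq_nnnorm]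
    _ ≤ 2 * A * N + A := by gcongr
    _ = (2 * N.toNNReal + 1 : ℝ≥0) * A := by
        push_cast
        rw [ENNReal.coe_toNNReal hNtop]; ring

theorem exists_eLpNorm_le_of_isDecoupled [IsProbabilityMeasure μ]
    (hW : IsAbstractWienerSpace i μ) {p : ℝ≥0} (hp : 2 ≤ p) :
    ∃ K : ℝ≥0, ∀ P : W → ℝ, IsDecoupled P → MemLp P 2 μ →
      eLpNorm P p μ ≤ K * eLpNorm P 2 μ := by
  have hp1 : 1 ≤ p := le_trans (by norm_num) hp
  obtain ⟨K, hK⟩ := exists_eLpNorm_affine_le hW hp1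
  refine ⟨K ^ 2 * 2 + 1, fun P hP hP2 => ?_⟩
  obtain ⟨hPm, G, hG, h1, h2, h3⟩ := hP
  have hrot := measurePreserving_rotation hW
  have hcomp : (fun z : W × W => P z.1 - P z.2) = Function.uncurry G ∘ rotation := by
    ext z; exact h3 z.1 z.2
  have hdiff : ∀ q : ℝ≥0∞, eLpNorm (fun z : W × W => P z.1 - P z.2) q (μ.prod μ)
      = eLpNorm (Function.uncurry G) q (μ.prod μ) := fun q => by
    rw [hcomp, eLpNorm_comp_measurePreserving hG.aestronglyMeasurable hrot]
  have hGle : eLpNorm (Function.uncurry G) p (μ.prod μ)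
      ≤ K ^ 2 * eLpNorm (Function.uncurry G) 2 (μ.prod μ) := by
    refine eLpNorm_prod_le_of_sections hp hG (fun y => ?_) fun x => ?_
    · obtain ⟨ℓ, hℓ⟩ := h1 y
      simp_rw [hℓ]
      simpa using hK ℓ 0
    · obtain ⟨ℓ, c, hℓ⟩ := h2 x
      simp_rw [hℓ]
      exact hK ℓ c
  have h22 : eLpNorm (fun z : W × W => P z.1 - P z.2) 2 (μ.prod μ) ≤ 2 * eLpNorm P 2 μ := by
    refine (eLpNorm_sub_le (hPm.comp measurable_fst).aestronglyMeasurable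
      (hPm.comp measurable_snd).aestronglyMeasurable (by norm_num)).trans_eq ?_
    rw [eLpNorm_comp_measurePreserving hPm.aestronglyMeasurable measurePreserving_fst,
      eLpNorm_comp_measurePreserving hPm.aestronglyMeasurable measurePreserving_snd, two_mul]
  have hPi : Integrable P μ := hP2.integrable (by norm_num)
  set m := ∫ w, P w ∂μ with hm
  have hc : eLpNorm (fun _ : W => m) p μ ≤ eLpNorm P 2 μ := by
    rw [eLpNorm_const m (by positivity) (IsProbabilityMeasure.ne_zero μ)]
    simpa using enorm_integral_le_eLpNorm_two hPm.aestronglyMeasurable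
  calc eLpNorm P p μ = eLpNorm ((fun w => P w - m) + fun _ => m) p μ := by
        congr 1; ext w; simp
    _ ≤ eLpNorm (fun w => P w - m) p μ + eLpNorm (fun _ : W => m) p μ :=
        eLpNorm_add_le (hPm.sub_const m).aestronglyMeasurable aestronglyMeasurable_const
          (by exact_mod_cast hp1)
    _ ≤ K ^ 2 * (2 * eLpNorm P 2 μ) + eLpNorm P 2 μ := by
        gcongr
        refine (eLpNorm_sub_integral_le hp1 hPm hPi).trans ?_
        rw [hdiff]
        refine hGle.trans ?_
        rw [← hdiff]
        gcongr
    _ = (K ^ 2 * 2 + 1 : ℝ≥0) * eLpNorm P 2 μ := by push_cast; ring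

/-- The polynomials of degree at most `n` in the elements of `W*`, whose closure is
`polySpace μ n`. -/
noncomputable def polySpan (μ : Measure W) (n : ℕ) : Submodule ℝ (Lp ℝ 2 μ) :=
  Submodule.span ℝ {F : Lp ℝ 2 μ | ∃ k ≤ n, ∃ ℓ : Fin k → W →L[ℝ] ℝ,
    F =ᵐ[μ] fun w => ∏ j, ℓ j w}

theorem exists_seq_polySpan_tendsto {n : ℕ} {F : Lp ℝ 2 μ} (hF : F ∈ polySpace μ n) :
    ∃ f : ℕ → Lp ℝ 2 μ, (∀ n', f n' ∈ polySpan μ n) ∧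
      Filter.Tendsto f Filter.atTop (nhds F) ∧
      ∀ᵐ w ∂μ, Filter.Tendsto (fun n => f n w) Filter.atTop (nhds (F w)) := by
  obtain ⟨x, hx, hlim⟩ := mem_closure_iff_seq_limit.1 hF
  obtain ⟨ns, hns, hae⟩ := exists_seq_ae_tendsto_of_tendsto_Lp hlim
  exact ⟨fun n => x (ns n), fun n => hx _, hlim.comp hns.tendsto_atTop, hae⟩

theorem exists_isDecoupled_of_mem_polySpan {F : Lp ℝ 2 μ} (hF : F ∈ polySpan μ 2) :
    ∃ P : W → ℝ, IsDecoupled P ∧ F =ᵐ[μ] P := by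
  induction hF using Submodule.span_induction with
  | mem F hF =>
    obtain ⟨k, hk, ℓ, h⟩ := hF
    exact ⟨_, isDecoupled_prod hk ℓ, h⟩
  | zero => exact ⟨_, isDecoupled_const 0, Lp.coeFn_zero _ _ _⟩
  | add F F' _ _ h h' =>
    obtain ⟨P, hP, e⟩ := h
    obtain ⟨P', hP', e'⟩ := h'
    exact ⟨_, hP.add hP', (Lp.coeFn_add F F').trans (e.add e')⟩
  | smul a F _ h =>
    obtain ⟨P, hP, e⟩ := h
    exact ⟨_, hP.const_mul a, (Lp.coeFn_smul a F).trans (e.const_smul a)⟩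

/-- On the closure of the polynomials of degree at most two all the `L^p` norms, `p < ∞`, are
bounded by the `L²` norm. -/
theorem exists_eLpNorm_le_of_mem_polySpace [IsProbabilityMeasure μ]
    (hW : IsAbstractWienerSpace i μ) {p : ℝ≥0∞} (hp : p ≠ ⊤) :
    ∃ K : ℝ≥0, ∀ F ∈ polySpace μ 2, eLpNorm F p μ ≤ K * ‖F‖ₑ := by
  lift p to ℝ≥0 using hp
  obtain ⟨K, hK⟩ := exists_eLpNorm_le_of_isDecoupled hW (le_max_left 2 p)
  have hspan : ∀ F ∈ polySpan μ 2, eLpNorm F p μ ≤ K * ‖F‖ₑ := by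
    intro F hF
    obtain ⟨P, hP, e⟩ := exists_isDecoupled_of_mem_polySpan hF
    refine (eLpNorm_le_eLpNorm_of_exponent_le (q := (max 2 p : ℝ≥0)) (by simp)
      (Lp.aestronglyMeasurable F)).trans ?_
    rw [Lp.enorm_def, eLpNorm_congr_ae e, eLpNorm_congr_ae e]
    exact hK P hP ((memLp_congr_ae e).1 (Lp.memLp F))
  refine ⟨K, fun F hF => ?_⟩
  obtain ⟨f, hf, hlim, hae⟩ := exists_seq_polySpan_tendsto hF
  refine (Lp.eLpNorm_lim_le_liminf_eLpNorm (fun n => Lp.aestronglyMeasurable (f n)) F hae).trans ?_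
  have h1 : Filter.Tendsto (fun n => (K : ℝ≥0∞) * ‖f n‖ₑ) Filter.atTop (nhds (K * ‖F‖ₑ)) :=
    ENNReal.Tendsto.const_mul ((continuous_enorm.tendsto F).comp hlim) (.inr (by simp))
  rw [← h1.liminf_eq]
  exact Filter.liminf_le_liminf (.of_forall fun n => hspan _ (hf n))

/-! ### Distributions on the chaoses of order at most two -/

theorem mem_testSpace_of_mem_chaos [IsProbabilityMeasure μ] (hW : IsAbstractWienerSpace i μ)
    {n : ℕ} (hn : n ≤ 2) {f : Lp ℝ 2 μ} (hf : f ∈ chaos μ n) : f ∈ testSpace μ := by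
  intro p _ hp' s
  obtain ⟨K, hK⟩ := exists_eLpNorm_le_of_mem_polySpace hW hp'
  refine ⟨_, isBesselPow_of_mem_chaos s hf, (memLp_congr_ae (Lp.coeFn_smul _ f)).2
    (MemLp.const_smul ⟨Lp.aestronglyMeasurable f, ?_⟩ _)⟩
  refine (hK f (polySpace_mono hn (chaos_le_polySpace n hf))).trans_lt ?_
  exact ENNReal.mul_lt_top (by simp) enorm_lt_top

theorem paleyWiener_mem_chaos [IsProbabilityMeasure μ] (hW : IsAbstractWienerSpace i μ) (h : H) :
    paleyWiener hW h ∈ chaos μ 1 := by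
  refine ⟨?_, mem_polySpace_orthogonal ?_⟩
  · refine (denseRange_adj hW.injective).induction_on h
      ((isClosed_polySpace 1).preimage (paleyWiener hW).continuous) fun ℓ => ?_
    refine Submodule.le_topologicalClosure _ (Submodule.subset_span ⟨1, le_rfl, fun _ => ℓ, ?_⟩)
    simpa using paleyWiener_adj_ae hW ℓ
  · intro k hk ℓ
    obtain rfl : k = 0 := Nat.le_zero.1 hk
    simpa using integral_paleyWiener hW h

theorem const_mem_polySpace [IsProbabilityMeasure μ] (n : ℕ) :
    Lp.const 2 μ (1 : ℝ) ∈ polySpace μ n :=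
  Submodule.le_topologicalClosure _ (Submodule.subset_span
    ⟨0, Nat.zero_le n, Fin.elim0, by
      simpa using (show Lp.const 2 μ (1 : ℝ) =ᵐ[μ] fun _ => (1 : ℝ) from
        Lp.coeFn_const (p := 2) (μ := μ) (1 : ℝ))⟩)

theorem divTwo_adj_add_const [IsProbabilityMeasure μ] (hW : IsAbstractWienerSpace i μ)
    (ℓ ℓ' : W →L[ℝ] ℝ) :
    (divTwo hW (adj i ℓ) (adj i ℓ') + ⟪adj i ℓ, adj i ℓ'⟫_ℝ • Lp.const 2 μ (1 : ℝ) : Lp ℝ 2 μ)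
      =ᵐ[μ] fun w => ℓ w * ℓ' w := by
  set c := ⟪adj i ℓ, adj i ℓ'⟫_ℝ with hc
  filter_upwards [coeFn_divTwo hW (adj i ℓ) (adj i ℓ'), paleyWiener_adj_ae hW ℓ,
    paleyWiener_adj_ae hW ℓ', Lp.coeFn_const (p := 2) (μ := μ) (1 : ℝ),
    Lp.coeFn_smul c (Lp.const 2 μ (1 : ℝ)),
    Lp.coeFn_add (divTwo hW (adj i ℓ) (adj i ℓ')) (c • Lp.const 2 μ (1 : ℝ))]
    with w h1 h2 h3 h4 h5 h6
  rw [h6, Pi.add_apply, h1, h2, h3, h5, Pi.smul_apply, h4]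
  simp [hc]

theorem divTwo_mem_polySpace [IsProbabilityMeasure μ] (hW : IsAbstractWienerSpace i μ) (h k : H) :
    divTwo hW h k ∈ polySpace μ 2 := by
  refine (denseRange_adj hW.injective).induction_on h
    ((isClosed_polySpace 2).preimage ((divTwoL hW).flip k).continuous) fun ℓ => ?_
  refine (denseRange_adj hW.injective).induction_on k
    ((isClosed_polySpace 2).preimage (divTwoL hW (adj i ℓ)).continuous) fun ℓ' => ?_
  have h1 := divTwo_adj_add_const hW ℓ ℓ'
  set c := ⟪adj i ℓ, adj i ℓ'⟫_ℝ
  have h2 : divTwo hW (adj i ℓ) (adj i ℓ') + c • Lp.const 2 μ (1 : ℝ) ∈ polySpace μ 2 :=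
    Submodule.le_topologicalClosure _ (Submodule.subset_span
      ⟨2, le_rfl, ![ℓ, ℓ'], by simpa [Fin.prod_univ_two] using h1⟩)
  simpa using (polySpace μ 2).sub_mem h2 ((polySpace μ 2).smul_mem c (const_mem_polySpace 2))

theorem divTwo_mem_chaos [IsProbabilityMeasure μ] (hW : IsAbstractWienerSpace i μ) (h k : H) :
    divTwo hW h k ∈ chaos μ 2 := by
  refine ⟨divTwo_mem_polySpace hW h k, mem_polySpace_orthogonal fun n hn ℓ => ?_⟩
  interval_cases n
  · simpa using integral_divTwo hW h k
  · rw [← integral_divTwo_mul_paleyWiener hW h k (adj i (ℓ 0))]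
    refine integral_congr_ae ?_
    filter_upwards [paleyWiener_adj_ae hW (ℓ 0)] with w hw
    simp [hw]

/-- On a chaos of order at most two, a distribution is continuous for the norm of `L²(μ)`. -/
theorem exists_bound_of_mem_chaos [IsProbabilityMeasure μ] (hW : IsAbstractWienerSpace i μ)
    {m : testSpace μ →ₗ[ℝ] ℝ} (hm : IsDistribution m) {n : ℕ} (hn : n ≤ 2) :
    ∃ K : ℝ, ∀ f : testSpace μ, (f : Lp ℝ 2 μ) ∈ chaos μ n → |m f| ≤ K * ‖(f : Lp ℝ 2 μ)‖ := by
  obtain ⟨p, s, C, -, hp, hC⟩ := hm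
  obtain ⟨K, hK⟩ := exists_eLpNorm_le_of_mem_polySpace hW hp
  set a : ℝ := (1 + n : ℝ) ^ (s / 2) with ha
  refine ⟨C * (‖a‖ * K), fun f hf => ?_⟩
  have h1 := hC f _ (isBesselPow_of_mem_chaos s hf)
  have h2 : eLpNorm (a • (f : Lp ℝ 2 μ) : Lp ℝ 2 μ) p μ
      ≤ ‖a‖ₑ * (K * ‖(f : Lp ℝ 2 μ)‖ₑ) := by
    rw [eLpNorm_congr_ae (Lp.coeFn_smul a _), eLpNorm_const_smul]
    gcongr
    exact hK _ (polySpace_mono hn (chaos_le_polySpace n hf))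
  have h3 : ENNReal.ofReal |m f| ≤ ENNReal.ofReal (C * (‖a‖ * K) * ‖(f : Lp ℝ 2 μ)‖) := by
    refine (h1.trans (mul_le_mul_right h2 _)).trans_eq ?_
    rw [ENNReal.ofReal_mul (by positivity), ENNReal.ofReal_mul (by positivity),
      ENNReal.ofReal_mul (by positivity), ENNReal.ofReal_coe_nnreal, ENNReal.ofReal_coe_nnreal,
      ofReal_norm, ofReal_norm]
    ring
  exact (ENNReal.ofReal_le_ofReal_iff (by positivity)).1 h3

/-- The projection of a distribution to a chaos of order at most two is represented by an element
of that chaos. -/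
theorem exists_isChaosProjection [IsProbabilityMeasure μ] (hW : IsAbstractWienerSpace i μ)
    {m : testSpace μ →ₗ[ℝ] ℝ} (hm : IsDistribution m) {n : ℕ} (hn : n ≤ 2) :
    ∃ F, IsChaosProjection m n F := by
  obtain ⟨K, hK⟩ := exists_bound_of_mem_chaos hW hm hn
  have : CompleteSpace (chaos μ n) := (isClosed_chaos n).completeSpace_coe
  let L : chaos μ n →L[ℝ] ℝ := LinearMap.mkContinuous
    (m ∘ₗ Submodule.inclusion fun _ hf => mem_testSpace_of_mem_chaos hW hn hf) K
    (fun f => hK _ f.2)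
  refine ⟨((InnerProductSpace.toDual ℝ (chaos μ n)).symm L : chaos μ n), Subtype.coe_prop _, ?_⟩
  intro φ ψ hψ hφψ
  set F := (InnerProductSpace.toDual ℝ (chaos μ n)).symm L with hF
  have h1 : ⟪(F : Lp ℝ 2 μ), (φ : Lp ℝ 2 μ)⟫_ℝ = ⟪(F : Lp ℝ 2 μ), (ψ : Lp ℝ 2 μ)⟫_ℝ := by
    rw [← sub_eq_zero, ← inner_sub_right]
    exact Submodule.inner_right_of_mem_orthogonal F.2 hφψ
  have h2 : ⟪F, ⟨ψ, hψ⟩⟫_ℝ = L ⟨ψ, hψ⟩ := InnerProductSpace.toDual_symm_apply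
  rw [h1]
  exact h2

theorem IsChaosProjection.inner_eq {m : testSpace μ →ₗ[ℝ] ℝ} {n : ℕ} {F : Lp ℝ 2 μ}
    (hF : IsChaosProjection m n F) {f : Lp ℝ 2 μ} (hf : f ∈ chaos μ n) (hft : f ∈ testSpace μ) :
    ⟪F, f⟫_ℝ = m ⟨f, hft⟩ :=
  hF.2 ⟨f, hft⟩ ⟨f, hft⟩ hf (by simp)

/-! ### Second differences along the Cameron-Martin space -/

/-- The identity which characterises the functionals whose second differences along `H` are
deterministic and given by the pairing with `δ²`. -/
def HasConstSecondDiff [IsProbabilityMeasure μ] (hW : IsAbstractWienerSpace i μ)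
    (F : Lp ℝ 2 μ) : Prop :=
  ∀ (h k : H) (s t : ℝ), s + t = 1 → ∀ᵐ w ∂μ,
    s * F (w + i h) + t * F (w + i k) - F (w + i (s • h + t • k))
      = s * t / 2 * ⟪F, divTwo hW (h - k) (h - k)⟫_ℝ

theorem hasConstSecondDiff_of_ae_eq_prod [IsProbabilityMeasure μ] (hW : IsAbstractWienerSpace i μ)
    {n : ℕ} (hn : n ≤ 2) (ℓ : Fin n → W →L[ℝ] ℝ) {F : Lp ℝ 2 μ}
    (hF : F =ᵐ[μ] fun w => ∏ j, ℓ j w) : HasConstSecondDiff hW F := by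
  intro h k s t hst
  obtain rfl : t = 1 - s := by linarith
  filter_upwards [ae_shift hW h hF, ae_shift hW k hF, ae_shift hW (s • h + (1 - s) • k) hF]
    with w h1 h2 h3
  have h4 : ⟪F, divTwo hW (h - k) (h - k)⟫_ℝ
      = ∫ w, divTwo hW (h - k) (h - k) w * ∏ j, ℓ j w ∂μ := by
    rw [real_inner_comm, real_inner_Lp_eq_integral]
    refine integral_congr_ae ?_
    filter_upwards [hF] with w hw
    rw [hw]
  rw [h1, h2, h3, h4]
  interval_cases n
  · simp [integral_divTwo]
  · have h5 : ∫ w, divTwo hW (h - k) (h - k) w * ∏ j, ℓ j w ∂μ = 0 := by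
      rw [← integral_divTwo_mul_paleyWiener hW (h - k) (h - k) (adj i (ℓ 0))]
      refine integral_congr_ae ?_
      filter_upwards [paleyWiener_adj_ae hW (ℓ 0)] with w hw
      simp [hw]
    rw [h5]
    simp only [Fin.prod_univ_one, map_add, map_smul, smul_eq_mul]
    ring
  · have h5 : ∫ w, divTwo hW (h - k) (h - k) w * ∏ j, ℓ j w ∂μ
        = 2 * (ℓ 0 (i (h - k)) * ℓ 1 (i (h - k))) := by
      have h6 := integral_divTwo_mul_paleyWiener_mul hW (h - k) (h - k)
        (adj i (ℓ 0)) (adj i (ℓ 1))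
      rw [real_inner_comm, inner_adj, real_inner_comm, inner_adj] at h6
      rw [two_mul]
      refine Eq.trans (integral_congr_ae ?_) (h6.trans (by ring))
      filter_upwards [paleyWiener_adj_ae hW (ℓ 0), paleyWiener_adj_ae hW (ℓ 1)] with w hw hw'
      simp [hw, hw', Fin.prod_univ_two]
    rw [h5]
    simp only [Fin.prod_univ_two, map_add, map_smul, map_sub, smul_eq_mul]
    ring

theorem HasConstSecondDiff.add [IsProbabilityMeasure μ] {hW : IsAbstractWienerSpace i μ}
    {F G : Lp ℝ 2 μ} (hF : HasConstSecondDiff hW F) (hG : HasConstSecondDiff hW G) :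
    HasConstSecondDiff hW (F + G) := by
  intro h k s t hst
  have e := Lp.coeFn_add F G
  filter_upwards [ae_shift hW h e, ae_shift hW k e, ae_shift hW (s • h + t • k) e,
    hF h k s t hst, hG h k s t hst] with w h1 h2 h3 h4 h5
  rw [h1, h2, h3, inner_add_left]
  simp only [Pi.add_apply]
  linear_combination h4 + h5

theorem HasConstSecondDiff.smul [IsProbabilityMeasure μ] {hW : IsAbstractWienerSpace i μ}
    {F : Lp ℝ 2 μ} (hF : HasConstSecondDiff hW F) (a : ℝ) : HasConstSecondDiff hW (a • F) := by
  intro h k s t hst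
  have e := Lp.coeFn_smul a F
  filter_upwards [ae_shift hW h e, ae_shift hW k e, ae_shift hW (s • h + t • k) e,
    hF h k s t hst] with w h1 h2 h3 h4
  rw [h1, h2, h3, real_inner_smul_left]
  simp only [Pi.smul_apply, smul_eq_mul]
  linear_combination a * h4

theorem hasConstSecondDiff_of_mem_polySpan [IsProbabilityMeasure μ]
    (hW : IsAbstractWienerSpace i μ) {F : Lp ℝ 2 μ} (hF : F ∈ polySpan μ 2) :
    HasConstSecondDiff hW F := by
  induction hF using Submodule.span_induction with
  | mem F hF =>
    obtain ⟨k, hk, ℓ, h⟩ := hF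
    exact hasConstSecondDiff_of_ae_eq_prod hW hk ℓ h
  | zero =>
    intro h k s t _
    have e := Lp.coeFn_zero ℝ 2 μ
    filter_upwards [ae_shift hW h e, ae_shift hW k e, ae_shift hW (s • h + t • k) e]
      with w h1 h2 h3
    rw [h1, h2, h3]
    simp
  | add F F' _ _ h h' => exact h.add h'
  | smul a F _ h => exact h.smul a

theorem hasConstSecondDiff_of_mem_polySpace [IsProbabilityMeasure μ]
    (hW : IsAbstractWienerSpace i μ) {F : Lp ℝ 2 μ} (hF : F ∈ polySpace μ 2) :
    HasConstSecondDiff hW F := by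
  intro h k s t hst
  obtain ⟨f, hf, hlim, hae⟩ := exists_seq_polySpan_tendsto hF
  have hall : ∀ᵐ w ∂μ, ∀ n, s * f n (w + i h) + t * f n (w + i k) - f n (w + i (s • h + t • k))
      = s * t / 2 * ⟪f n, divTwo hW (h - k) (h - k)⟫_ℝ :=
    ae_all_iff.2 fun n => hasConstSecondDiff_of_mem_polySpan hW (hf n) h k s t hst
  filter_upwards [ae_shift hW h hae, ae_shift hW k hae, ae_shift hW (s • h + t • k) hae, hall]
    with w h1 h2 h3 h4
  refine tendsto_nhds_unique (((h1.const_mul s).add (h2.const_mul t)).sub h3) ?_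
  simp_rw [h4]
  exact (hlim.inner tendsto_const_nhds).const_mul _

/-! ### The mean Hessian -/

/-- The operator `T` on `H` with `(T h, k) = E[F δ²(h ⊗ k)]`; for smooth `F` it is the mean Hessian
`E[∇²F]`. -/
noncomputable def meanHessian [IsProbabilityMeasure μ] (hW : IsAbstractWienerSpace i μ)
    (F : Lp ℝ 2 μ) : H →L[ℝ] H :=
  LinearMap.mkContinuous
    { toFun := fun h => ContinuousLinearMap.adjoint (divTwoL hW h) F
      map_add' := fun h k => by simp
      map_smul' := fun c h => by
        refine ext_inner_right ℝ fun k => ?_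
        simp [ContinuousLinearMap.adjoint_inner_left, real_inner_smul_left] }
    (‖divTwoL hW‖ * ‖F‖) fun h => by
      refine ((ContinuousLinearMap.adjoint (divTwoL hW h)).le_opNorm F).trans ?_
      rw [LinearIsometryEquiv.norm_map, mul_right_comm]
      gcongr
      exact (divTwoL hW).le_opNorm h

theorem inner_meanHessian [IsProbabilityMeasure μ] (hW : IsAbstractWienerSpace i μ)
    (F : Lp ℝ 2 μ) (h k : H) : ⟪meanHessian hW F h, k⟫_ℝ = ⟪F, divTwo hW h k⟫_ℝ := by
  change ⟪ContinuousLinearMap.adjoint (divTwoL hW h) F, k⟫_ℝ = _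
  rw [ContinuousLinearMap.adjoint_inner_left, divTwoL_apply]

theorem inner_meanHessian_comm [IsProbabilityMeasure μ] (hW : IsAbstractWienerSpace i μ)
    (F : Lp ℝ 2 μ) (h k : H) : ⟪meanHessian hW F h, k⟫_ℝ = ⟪h, meanHessian hW F k⟫_ℝ := by
  rw [real_inner_comm _ h, inner_meanHessian, inner_meanHessian, divTwo_comm]

/-- With `S = ∑ |T e|²`, where `T` is the mean Hessian, `S = E[F ∑ δ²(e ⊗ T e)]`, and the sum on
the right has variance at most `2 S`. -/
theorem isHilbertSchmidt_meanHessian [IsProbabilityMeasure μ] (hW : IsAbstractWienerSpace i μ)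
    (F : Lp ℝ 2 μ) : IsHilbertSchmidt (meanHessian hW F) := by
  set T := meanHessian hW F with hT
  intro e he
  refine summable_of_sum_le (c := 2 * ‖F‖ ^ 2) (fun _ => sq_nonneg _) fun s => ?_
  set S := ∑ x ∈ s, ‖T x‖ ^ 2 with hS
  set G := ∑ x ∈ s, divTwo hW (x : H) (T x) with hG
  have hS0 : 0 ≤ S := Finset.sum_nonneg fun _ _ => sq_nonneg _
  have h1 : S = ⟪F, G⟫_ℝ := by
    rw [hG, inner_sum]
    refine Finset.sum_congr rfl fun x _ => ?_
    rw [← inner_meanHessian, real_inner_self_eq_norm_sq]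
  have h2 : ‖G‖ ^ 2 ≤ 2 * S := by
    have h3 : ‖G‖ ^ 2 = ∑ y ∈ s, ∑ x ∈ s, ⟪(x : H), (y : H)⟫_ℝ * ⟪T x, T y⟫_ℝ
        + ∑ y ∈ s, ∑ x ∈ s, ⟪(x : H), T y⟫_ℝ ^ 2 := by
      rw [← real_inner_self_eq_norm_sq, hG, inner_sum, ← Finset.sum_add_distrib]
      refine Finset.sum_congr rfl fun y _ => ?_
      rw [sum_inner, ← Finset.sum_add_distrib]
      refine Finset.sum_congr rfl fun x _ => ?_
      rw [inner_divTwo, inner_meanHessian_comm hW F x y, ← hT]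
      ring
    have h4 : ∀ y ∈ s, ∑ x ∈ s, ⟪(x : H), (y : H)⟫_ℝ * ⟪T x, T y⟫_ℝ = ‖T y‖ ^ 2 := by
      intro y hy
      rw [Finset.sum_eq_single_of_mem y hy, real_inner_self_eq_norm_sq,
        real_inner_self_eq_norm_sq, he.1 y]
      · ring
      · intro x _ hxy
        rw [he.2 hxy, zero_mul]
    have h5 : ∀ y ∈ s, ∑ x ∈ s, ⟪(x : H), T y⟫_ℝ ^ 2 ≤ ‖T y‖ ^ 2 := by
      intro y _
      simpa using he.sum_inner_products_le (T y) (s := s)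
    rw [h3, two_mul, Finset.sum_congr rfl h4]
    exact add_le_add le_rfl (Finset.sum_le_sum h5)
  have h6 : S ≤ ‖F‖ * ‖G‖ := h1 ▸ real_inner_le_norm F G
  by_contra hlt
  push Not at hlt
  have h7 : S * S ≤ (‖F‖ * ‖G‖) * (‖F‖ * ‖G‖) := mul_self_le_mul_self hS0 h6
  have h8 : S * S ≤ ‖F‖ ^ 2 * (2 * S) := by nlinarith [sq_nonneg ‖F‖]
  have hSpos : 0 < S := lt_of_le_of_lt (by positivity) hlt
  nlinarith

/-! ### Positivity -/

theorem mass_nonneg [IsProbabilityMeasure μ] {m : testSpace μ →ₗ[ℝ] ℝ}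
    (hpos : IsPositiveDistribution m) : 0 ≤ mass m := by
  refine hpos _ ?_
  filter_upwards [Lp.coeFn_const (p := 2) (μ := μ) (1 : ℝ)] with w hw
  rw [hw]
  exact zero_le_one

/-- Positivity tested on `(δh + c)² = δ²(h ⊗ h) + 2 c δh + (|h|² + c²)`. -/
theorem IsPositiveDistribution.quadratic_nonneg [IsProbabilityMeasure μ]
    (hW : IsAbstractWienerSpace i μ) {m : testSpace μ →ₗ[ℝ] ℝ} (hpos : IsPositiveDistribution m)
    {h : H} (h₁ : paleyWiener hW h ∈ testSpace μ) (h₂ : divTwo hW h h ∈ testSpace μ) (c : ℝ) :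
    0 ≤ m ⟨_, h₂⟩ + 2 * c * m ⟨_, h₁⟩ + (‖h‖ ^ 2 + c ^ 2) * mass m := by
  have key := hpos ((⟨_, h₂⟩ : testSpace μ) + (2 * c) • (⟨_, h₁⟩ : testSpace μ)
    + (‖h‖ ^ 2 + c ^ 2) • ⟨Lp.const 2 μ (1 : ℝ), const_one_mem_testSpace μ⟩) ?_
  · rw [map_add, map_add, map_smul, map_smul] at key
    exact key
  · simp only [Submodule.coe_add, Submodule.coe_smul]
    filter_upwards [Lp.coeFn_add (divTwo hW h h + (2 * c) • paleyWiener hW h)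
        ((‖h‖ ^ 2 + c ^ 2) • Lp.const 2 μ (1 : ℝ)),
      Lp.coeFn_add (divTwo hW h h) ((2 * c) • paleyWiener hW h),
      Lp.coeFn_smul (2 * c) (paleyWiener hW h),
      Lp.coeFn_smul (‖h‖ ^ 2 + c ^ 2) (Lp.const 2 μ (1 : ℝ)),
      Lp.coeFn_const (p := 2) (μ := μ) (1 : ℝ), coeFn_divTwo hW h h] with w e1 e2 e3 e4 e5 e6
    rw [e1, Pi.add_apply, e2, Pi.add_apply, e3, e4, Pi.smul_apply, Pi.smul_apply, e5, e6,
      real_inner_self_eq_norm_sq]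
    simp only [smul_eq_mul, Function.const_apply]
    nlinarith [sq_nonneg (paleyWiener hW h w + c)]

end WienerSpace

theorem corollary2 {W H : Type*}
    [AddCommGroup W] [Module ℝ W] [TopologicalSpace W] [IsTopologicalAddGroup W]
    [ContinuousSMul ℝ W] [LocallyConvexSpace ℝ W] [PolishSpace W]
    [MeasurableSpace W] [BorelSpace W]
    [NormedAddCommGroup H] [InnerProductSpace ℝ H] [CompleteSpace H]
    (i : H →L[ℝ] W) (μ : Measure W) [IsProbabilityMeasure μ]
    (hW : IsAbstractWienerSpace i μ)
    (m : testSpace μ →ₗ[ℝ] ℝ) (hm : IsDistribution m) (hpos : IsPositiveDistribution m)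
    (hmass : mass m ≠ 0) :
    ∃ (M₁ : H) (M₂ : H →L[ℝ] H) (m₂ : Lp ℝ 2 μ),
      (∀ h : H, ∃ Z : testSpace μ, IsDivergence i μ ![h] (Z : Lp ℝ 2 μ) ∧ ⟪M₁, h⟫_ℝ = m Z) ∧
      (∀ h k : H, ∃ Z : testSpace μ,
        IsDivergence i μ ![h, k] (Z : Lp ℝ 2 μ) ∧ ⟪M₂ h, k⟫_ℝ = m Z) ∧
      IsHilbertSchmidt M₂ ∧
      IsChaosProjection m 2 m₂ ∧
      ((mass m) ^ 2)⁻¹ • InnerProductSpace.rankOne ℝ M₁ M₁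
        ≤ ContinuousLinearMap.id ℝ H + (mass m)⁻¹ • M₂ ∧
      IsRConvex i μ 1 (fun w => (mass m)⁻¹ * m₂ w) := by
  obtain ⟨m₁, hm₁⟩ := exists_isChaosProjection hW hm one_le_two
  obtain ⟨m₂, hm₂⟩ := exists_isChaosProjection hW hm le_rfl
  have ht₁ : ∀ h, paleyWiener hW h ∈ testSpace μ := fun h =>
    mem_testSpace_of_mem_chaos hW one_le_two (paleyWiener_mem_chaos hW h)
  have ht₂ : ∀ h k, divTwo hW h k ∈ testSpace μ := fun h k =>
    mem_testSpace_of_mem_chaos hW le_rfl (divTwo_mem_chaos hW h k)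
  set M₁ : H := ContinuousLinearMap.adjoint (paleyWiener hW) m₁ with hM₁
  set M₂ := meanHessian hW m₂ with hM₂
  have e₁ : ∀ h, ⟪M₁, h⟫_ℝ = m ⟨_, ht₁ h⟩ := fun h => by
    rw [hM₁, ContinuousLinearMap.adjoint_inner_left,
      hm₁.inner_eq (paleyWiener_mem_chaos hW h) (ht₁ h)]
  have e₂ : ∀ h k, ⟪M₂ h, k⟫_ℝ = m ⟨_, ht₂ h k⟩ := fun h k => by
    rw [hM₂, inner_meanHessian, hm₂.inner_eq (divTwo_mem_chaos hW h k) (ht₂ h k)]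
  have ha : 0 < mass m := lt_of_le_of_ne (mass_nonneg hpos) hmass.symm
  set a := mass m with ha'
  -- the minimum over `c` of the quadratic inequality is attained at `c = -(M₁, h) / a`
  have key : ∀ h, (a ^ 2)⁻¹ * ⟪M₁, h⟫_ℝ ^ 2 ≤ ‖h‖ ^ 2 + a⁻¹ * ⟪M₂ h, h⟫_ℝ := by
    intro h
    have h1 := hpos.quadratic_nonneg hW (ht₁ h) (ht₂ h h) (-(⟪M₁, h⟫_ℝ / a))
    rw [← e₁, ← e₂, ← ha'] at h1
    have h2 := mul_nonneg (inv_pos.2 ha).le h1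
    have h3 : a⁻¹ * (⟪M₂ h, h⟫_ℝ + 2 * -(⟪M₁, h⟫_ℝ / a) * ⟪M₁, h⟫_ℝ
        + (‖h‖ ^ 2 + (-(⟪M₁, h⟫_ℝ / a)) ^ 2) * a)
        = ‖h‖ ^ 2 + a⁻¹ * ⟪M₂ h, h⟫_ℝ - (a ^ 2)⁻¹ * ⟪M₁, h⟫_ℝ ^ 2 := by
      field_simp
      ring
    linarith
  refine ⟨M₁, M₂, m₂, fun h => ⟨⟨_, ht₁ h⟩, isDivergence_paleyWiener hW h, e₁ h⟩,
    fun h k => ⟨⟨_, ht₂ h k⟩, isDivergence_divTwo hW h k, e₂ h k⟩,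
    isHilbertSchmidt_meanHessian hW m₂, hm₂, ?_, ?_⟩
  · rw [ContinuousLinearMap.le_def, ContinuousLinearMap.isPositive_iff]
    have happ : ∀ x y, ⟪(ContinuousLinearMap.id ℝ H + a⁻¹ • M₂
        - (a ^ 2)⁻¹ • InnerProductSpace.rankOne ℝ M₁ M₁) x, y⟫_ℝ
        = ⟪x, y⟫_ℝ + a⁻¹ * ⟪M₂ x, y⟫_ℝ - (a ^ 2)⁻¹ * (⟪M₁, x⟫_ℝ * ⟪M₁, y⟫_ℝ) := fun x y => by
      simp [inner_add_left, inner_sub_left, real_inner_smul_left]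
    refine ⟨fun x y => ?_, fun x => ?_⟩
    · have h1 := happ y x
      rw [real_inner_comm] at h1
      have h2 : ⟪M₂ x, y⟫_ℝ = ⟪M₂ y, x⟫_ℝ := by
        rw [hM₂, inner_meanHessian_comm, real_inner_comm]
      rw [ContinuousLinearMap.coe_coe, happ, h1, h2, real_inner_comm x y]
      ring
    · rw [happ, real_inner_self_eq_norm_sq]
      linarith [key x]
  · intro h k s t hs ht hst
    filter_upwards [hasConstSecondDiff_of_mem_polySpace hW (chaos_le_polySpace 2 hm₂.1) h k s t hst]
      with w hw
    rw [← inner_meanHessian, ← hM₂] at hw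
    have h1 : 0 ≤ ‖h - k‖ ^ 2 + a⁻¹ * ⟪M₂ (h - k), h - k⟫_ℝ :=
      le_trans (by positivity) (key (h - k))
    have h2 : s * ‖h‖ ^ 2 + t * ‖k‖ ^ 2 - ‖s • h + t • k‖ ^ 2 = s * t * ‖h - k‖ ^ 2 := by
      obtain rfl : t = 1 - s := by linarith
      rw [norm_add_sq_real, norm_sub_sq_real, norm_smul, norm_smul, mul_pow, mul_pow,
        real_inner_smul_left, real_inner_smul_right, Real.norm_eq_abs, Real.norm_eq_abs, sq_abs,
        sq_abs]
      ring
    have h3 := mul_nonneg (mul_nonneg hs ht) h1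
    linear_combination h3 / 2 - h2 / 2 - a⁻¹ * hw
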